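/- Let $G$ be a finite group, let $\rho$ be an irreducible finite-dimensional $\mathbb{Q}$-linear representation of $G$, let $n \geq 1$ and $V = \rho^n$. Let $V^*$ be the contragredient representation, and let $\widetilde\sigma$ be the involution of the $\mathbb{Q}$-algebra $\widetilde A = \operatorname{End}_G(V \oplus V^*)$ that sends an endomorphism to its adjoint with respect to the nondegenerate symmetric $G$-invariant bilinear form $$b((v,\eta),(v',\eta')) = \eta(v') + \eta'(v).$$ Let $\rho_i$ be any irreducible constituent of the complex representation $\rho \otimes_{\mathbb{Q}} \mathbb{C}$. Then $\widetilde A$ is a simple ring, and: - if $\rho_i$ is not self-dual, then $\widetilde\sigma$ is an involution of the second kind; - if $\rho_i$ is self-dual and $(\bigwedge^2 \rho_i)^G \neq 0$, then $\widetilde\sigma$ is a symplectic involution; - if $\rho_i$ is self-dual and $(\bigwedge^2 \rho_i)^G = 0$, then $\widetilde\sigma$ is an orthogonal involution. Here an involution of a simple algebra $A$ with centre $F$ is of the first kind if it is the identity on $F$, and of the second kind otherwise. An involution $\sigma$ of the first kind is symplectic (respectively orthogonal) if, for every field extension $L/F$, every finite-dimensional $L$-vector space $W$ with a nondegenerate bilinear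 form $\beta$, and every isomorphism $(L \otimes_F A, \mathrm{id} \otimes \sigma) \cong (\operatorname{End}_L(W), \sigma_\beta)$, where $\sigma_\beta$ is the adjoint involution of $\beta$, the form $\beta$ is alternating (respectively symmetric and not alternating); such $L$, $W$, $\beta$ and isomorphism exist. -/

import Mathlib

open scoped TensorProduct

namespace RepInvolution

universe u v w

noncomputable section

section Constructions

variable {K : Type v} [Field K] {G : Type w} [Group G] {V : Type u} [AddCommGroup V] [Module K V]

/-- The `n`-fold direct sum `ρⁿ` of a representation. -/
def power (ρ : Representation K G V) (n : ℕ) : Representation K G (Fin n → V) where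
  toFun g := (ρ g).compLeft (Fin n)
  map_one' := by ext; simp
  map_mul' g h := by ext; simp

/-- The representation `V ⊕ V*`, where `V*` is the contragredient representation. -/
abbrev doubled (ρ : Representation K G V) : Representation K G (V × Module.Dual K V) :=
  ρ.prod ρ.dual

/-- The symmetric bilinear form `b((v, η), (v', η')) = η(v') + η'(v)` on `V ⊕ V*`. -/
def dualityForm (K : Type v) [Field K] (V : Type u) [AddCommGroup V] [Module K V] :
    LinearMap.BilinForm K (V × Module.Dual K V) :=
  LinearMap.mk₂ K (fun x y => x.2 y.1 + y.2 x.1)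
    (by intros; simp; ring) (by intros; simp; ring) (by intros; simp; ring) (by intros; simp; ring)

@[simp]
theorem dualityForm_apply (x y : V × Module.Dual K V) :
    dualityForm K V x y = x.2 y.1 + y.2 x.1 := rfl

theorem dualityForm_comm (x y : V × Module.Dual K V) :
    dualityForm K V x y = dualityForm K V y x := by
  simp [add_comm]

theorem dualityForm_nondegenerate : (dualityForm K V).Nondegenerate := by
  have h : ∀ x, (∀ y, dualityForm K V x y = 0) → x = 0 := by
    rintro ⟨x, η⟩ h
    refine Prod.ext ?_ ?_
    · refine (Module.forall_dual_apply_eq_zero_iff K x).1 fun φ => ?_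
      simpa using h (0, φ)
    · ext y
      simpa using h (y, 0)
  exact ⟨h, fun y hy => h y fun x => by rw [dualityForm_comm]; exact hy x⟩

/-- The form on `V ⊕ V*` is invariant under `G`. -/
theorem dualityForm_invariant (ρ : Representation K G V) (g : G) (x y : V × Module.Dual K V) :
    dualityForm K V (doubled ρ g x) (doubled ρ g y) = dualityForm K V x y := by
  simp [doubled, Representation.dual_apply, Module.Dual.transpose_apply]

theorem dualityForm_move (ρ : Representation K G V) (g : G) (x y : V × Module.Dual K V) :
    dualityForm K V (doubled ρ g x) y = dualityForm K V x (doubled ρ g⁻¹ y) := by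
  rw [← dualityForm_invariant ρ g x]
  simp only [Representation.self_inv_apply]

/-- The algebra `End_G(V)` of a representation `V` of `G`. -/
abbrev EndG (ρ : Representation K G V) : Type u := ρ.IntertwiningMap ρ

/-- `End_G(V)` as a ring; the underlying semiring structure is the one of `IntertwiningMap`. -/
instance instRingEndG (ρ : Representation K G V) : Ring (EndG ρ) :=
  { Representation.IntertwiningMap.instSemiring ρ, (inferInstance : AddCommGroup (EndG ρ)) with }

variable [FiniteDimensional K V]

/-- The adjoint of a linear endomorphism of `V ⊕ V*` with respect to the duality form. -/
def adjointMap (f : Module.End K (V × Module.Dual K V)) : Module.End K (V × Module.Dual K V) :=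
  (dualityForm K V).leftAdjointOfNondegenerate dualityForm_nondegenerate f

theorem adjointMap_left (f : Module.End K (V × Module.Dual K V)) (x y : V × Module.Dual K V) :
    dualityForm K V (adjointMap f x) y = dualityForm K V x (f y) :=
  LinearMap.BilinForm.isAdjointPairLeftAdjointOfNondegenerate _ dualityForm_nondegenerate f x y

theorem eq_adjointMap {f g : Module.End K (V × Module.Dual K V)}
    (h : ∀ x y, dualityForm K V (g x) y = dualityForm K V x (f y)) : g = adjointMap f :=
  (LinearMap.BilinForm.isAdjointPair_iff_eq_of_nondegenerate _ dualityForm_nondegenerate g f).1 h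

/-- The adjoint of a `G`-equivariant endomorphism of `V ⊕ V*`, which is again `G`-equivariant. -/
def adjointG (ρ : Representation K G V) (f : EndG (doubled ρ)) : EndG (doubled ρ) where
  toLinearMap := adjointMap f.toLinearMap
  isIntertwining' g := by
    refine LinearMap.ext fun x => ?_
    refine sub_eq_zero.1 (dualityForm_nondegenerate.1 _ fun y => ?_)
    rw [map_sub, LinearMap.sub_apply, sub_eq_zero]
    have hf := LinearMap.congr_fun (f.isIntertwining' g⁻¹) y
    simp only [LinearMap.comp_apply] at hf ⊢
    rw [adjointMap_left, dualityForm_move, dualityForm_move, adjointMap_left, hf]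

/-- The involution of `End_G(V ⊕ V*)` which sends an endomorphism to its adjoint with respect to
the form `b((v, η), (v', η')) = η(v') + η'(v)`. -/
def tildeSigma (ρ : Representation K G V) : RingInvo (EndG (doubled ρ)) :=
  RingInvo.mk'
    { toFun := fun f => MulOpposite.op (adjointG ρ f)
      map_one' := by
        refine congrArg MulOpposite.op ?_
        refine Representation.IntertwiningMap.ext ?_
        exact (eq_adjointMap fun x y => rfl).symm
      map_mul' := fun f g => by
        rw [← MulOpposite.op_mul]
        refine congrArg MulOpposite.op ?_
        refine Representation.IntertwiningMap.ext ?_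
        refine (eq_adjointMap fun x y => ?_).symm
        change dualityForm K V (adjointMap g.toLinearMap (adjointMap f.toLinearMap x)) y =
          dualityForm K V x (f.toLinearMap (g.toLinearMap y))
        rw [adjointMap_left, adjointMap_left]
      map_zero' := by
        refine congrArg MulOpposite.op ?_
        refine Representation.IntertwiningMap.ext ?_
        refine (eq_adjointMap fun x y => ?_).symm
        change dualityForm K V 0 y = dualityForm K V x 0
        simp
      map_add' := fun f g => by
        rw [← MulOpposite.op_add]
        refine congrArg MulOpposite.op ?_
        refine Representation.IntertwiningMap.ext ?_
        refine (eq_adjointMap fun x y => ?_).symm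
        change dualityForm K V (adjointMap f.toLinearMap x + adjointMap g.toLinearMap x) y =
          dualityForm K V x (f.toLinearMap y + g.toLinearMap y)
        rw [map_add, map_add, LinearMap.add_apply, adjointMap_left, adjointMap_left] }
    (fun f => by
      refine Representation.IntertwiningMap.ext ?_
      refine (eq_adjointMap fun x y => ?_).symm
      change dualityForm K V (f.toLinearMap x) y =
        dualityForm K V x (adjointMap f.toLinearMap y)
      rw [dualityForm_comm x, adjointMap_left, dualityForm_comm])

/-- The defining property of the involution: `b(σ(f)(x), y) = b(x, f(y))`. -/
theorem tildeSigma_adjoint (ρ : Representation K G V) (f : EndG (doubled ρ))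
    (x y : V × Module.Dual K V) :
    dualityForm K V ((tildeSigma ρ f).unop x) y = dualityForm K V x (f y) :=
  adjointMap_left f.toLinearMap x y

end Constructions

section Types

/-- An involution is of the first kind if it is trivial on the centre. -/
def IsFirstKind {A : Type u} [Ring A] (σ : RingInvo A) : Prop :=
  ∀ z ∈ Subring.center A, (σ z).unop = z

/-- An involution is of the second kind (unitary) if it is nontrivial on the centre. -/
def IsSecondKind {A : Type u} [Ring A] (σ : RingInvo A) : Prop :=
  ∃ z ∈ Subring.center A, (σ z).unop ≠ z

/-- An isomorphism `(L ⊗_F A, id ⊗ σ) ≅ (End_L(W), σ_b)`, where `F` is the centre of `A`,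
`b` is a nondegenerate bilinear form on `W` and `σ_b` is the adjoint involution of `b`, which is
characterised by `b(x, f(y)) = b(σ_b(f)(x), y)`. As `L ⊗_F A` is spanned over `L` by the elements
`1 ⊗ a`, compatibility with the involutions is only required for these elements. -/
structure Splitting {A : Type u} [Ring A] (σ : RingInvo A) (L : Type u) [Field L]
    [Algebra (Subring.center A) L] (W : Type u) [AddCommGroup W] [Module L W] where
  /-- the isomorphism of algebras -/
  iso : (L ⊗[Subring.center A] A) ≃ₐ[L] Module.End L W
  /-- the bilinear form -/
  form : LinearMap.BilinForm L W
  nondegenerate : form.Nondegenerate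
  adjoint : ∀ (a : A) (x y : W),
    form x (iso (1 ⊗ₜ[Subring.center A] a) y) =
      form (iso (1 ⊗ₜ[Subring.center A] (σ a).unop) x) y

/-- There is a splitting of `(A, σ)` over some extension field of the centre. -/
def HasSplitting {A : Type u} [Ring A] (σ : RingInvo A) : Prop :=
  ∃ (L : Type u) (_ : Field L) (_ : Algebra (Subring.center A) L)
    (W : Type u) (_ : AddCommGroup W) (_ : Module L W) (_ : FiniteDimensional L W),
    Nonempty (Splitting σ L W)

/-- An involution (of a simple algebra) is symplectic if it is of the first kind and if it becomes
adjoint to an alternating form over every splitting field. -/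
def IsSymplectic {A : Type u} [Ring A] (σ : RingInvo A) : Prop :=
  IsFirstKind σ ∧ HasSplitting σ ∧
    ∀ (L : Type u) [Field L] [Algebra (Subring.center A) L]
      (W : Type u) [AddCommGroup W] [Module L W] [FiniteDimensional L W]
      (s : Splitting σ L W), s.form.IsAlt

/-- An involution (of a simple algebra) is orthogonal if it is of the first kind and if it becomes
adjoint to a symmetric, non-alternating form over every splitting field. -/
def IsOrthogonal {A : Type u} [Ring A] (σ : RingInvo A) : Prop :=
  IsFirstKind σ ∧ HasSplitting σ ∧
    ∀ (L : Type u) [Field L] [Algebra (Subring.center A) L]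
      (W : Type u) [AddCommGroup W] [Module L W] [FiniteDimensional L W]
      (s : Splitting σ L W), s.form.IsSymm ∧ ¬ s.form.IsAlt

end Types

section Complex

variable {G : Type w} [Group G]

/-- The complexification `ℂ ⊗_ℚ ρ` of a rational representation. -/
def complexify {U : Type u} [AddCommGroup U] [Module ℚ U] (ρ : Representation ℚ G U) :
    Representation ℂ G (ℂ ⊗[ℚ] U) where
  toFun g := (ρ g).baseChange ℂ
  map_one' := by
    rw [map_one]
    exact LinearMap.baseChange_id
  map_mul' g h := by
    rw [map_mul]
    exact LinearMap.baseChange_comp _ _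

variable {T : Type v} [AddCommGroup T] [Module ℂ T]

/-- `τ` is an irreducible constituent of the complex representation `π`: it is irreducible and
isomorphic to a subrepresentation of `π`. -/
def IsIrreducibleConstituent {X : Type u} [AddCommGroup X] [Module ℂ X]
    (τ : Representation ℂ G T) (π : Representation ℂ G X) : Prop :=
  τ.IsIrreducible ∧ ∃ f : τ.IntertwiningMap π, Function.Injective f

/-- A representation is self-dual if it is isomorphic to its dual. -/
def IsSelfDual (τ : Representation ℂ G T) : Prop := Nonempty (τ.Equiv τ.dual)

/-- The exterior square of a representation. -/
def extSquare (τ : Representation ℂ G T) : Representation ℂ G (⋀[ℂ]^2 T) where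
  toFun g := exteriorPower.map 2 (τ g)
  map_one' := by
    rw [map_one]
    exact exteriorPower.map_id
  map_mul' g h := by
    rw [map_mul, Module.End.mul_eq_comp, Module.End.mul_eq_comp, exteriorPower.map_comp]

end Complex

end

end RepInvolution

/-! Write `Ã` for `End_G(V ⊕ V*)`, `σ` for its involution, `F` for its centre and `τ` for the chosen
complex constituent.

Simplicity: averaging a sum of squares gives a positive definite invariant form on `ρ`, so `ρ ≅ ρ*`
over `ℚ`. Hence `V ⊕ V* ≅ ρ²ⁿ`, and `Ã` is a matrix ring over the division ring `End_G(ρ)`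
(`isSimpleRing_endG`).

Non-self-dual `τ`: the class sum of `x ∈ G` acts as a central element of `Ã`, and `σ` sends it to
the class sum of `x⁻¹`. If `σ` fixed the centre, the two class sums would agree on `ρ`, hence on
`τ`. Taking traces, the character of `τ` would agree at `x` and `x⁻¹`, making `τ` self-dual
(`isSecondKind_of_not_isSelfDual`).

Self-dual `τ`: let `c` be a nondegenerate invariant form on `τ`, and let `H = Hom_G(τ, ℂ ⊗ (V ⊕
V*))`, on which `Ã` acts. By Schur's lemma the complexified form satisfies `b(h s, h' t) = β(h, h')
c(s, t)` for a form `β` on `H` (`exists_multForm`). This `β` is nondegenerate, induces `σ` as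
adjoint, and has the same sign as `c` because `b` is symmetric. The image of `Ã` spans `End(H)`
(`span_range_multAction_eq_top`), so `ℂ ⊗_F Ã ≅ End(H)` and `β` gives one splitting of `(Ã, σ)`. The
sign of `c` is read off from the invariants of `⋀² τ`.

Every other splitting has the same sign: the `F`-linear trace of `σ` equals the sign times the
degree (`Splitting.algebraMap_trace`), and the characteristic is zero (`Splitting.sign_eq`). -/

namespace RepInvolution

universe u v w

noncomputable section

/-! ### Scalar extension of a simple ring from its centre -/

section CentralSimple

variable {A : Type u} [Ring A] [IsSimpleRing A]

/-- If the two-sided ideal cut out by an additive predicate is nonzero, it contains `1`. -/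
theorem one_mem_of_isSimpleRing (P : A → Prop) (h0 : P 0) (hadd : ∀ x y, P x → P y → P (x + y))
    (hneg : ∀ x, P x → P (-x)) (hl : ∀ c x, P x → P (c * x)) (hr : ∀ c x, P x → P (x * c))
    {x : A} (hx : P x) (hx0 : x ≠ 0) : P 1 := by
  let I : TwoSidedIdeal A := TwoSidedIdeal.mk' {x | P x} h0 (fun {x y} => hadd x y)
    (fun {x} => hneg x) (fun {c x} => hl c x) (fun {x c} => hr c x)
  have hI : ∀ y, y ∈ I ↔ P y := fun y => TwoSidedIdeal.mem_mk' _ _ _ _ _ _ _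
  exact (hI 1).1 (IsSimpleRing.one_mem_of_ne_zero_mem I hx0 ((hI x).2 hx))

variable {L : Type*} [Field L] [Algebra (Subring.center A) L]
  {B : Type*} [Ring B] [Nontrivial B] [Algebra L B]

/-- Coefficients which are linearly independent over the centre of a simple ring stay linearly
independent over the whole ring. -/
theorem eq_zero_of_sum_smul_eq_zero (φ : A →+* B)
    (hφ : ∀ z : Subring.center A, φ z = algebraMap L B (algebraMap (Subring.center A) L z))
    {ι : Type*} (l : ι → L) (hl : LinearIndependent (Subring.center A) l) (s : Finset ι) :
    ∀ a : ι → A, ∑ i ∈ s, l i • φ (a i) = 0 → ∀ i ∈ s, a i = 0 := by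
  classical
  induction s using Finset.induction_on with
  | empty => simp
  | insert j s hj ih =>
    intro a ha
    suffices haj : a j = 0 by
      rw [Finset.sum_insert hj, haj, map_zero, smul_zero, zero_add] at ha
      intro i hi
      rcases Finset.mem_insert.1 hi with rfl | hi
      · exact haj
      · exact ih a ha i hi
    by_contra haj
    -- The `j`-th coefficients of all relations supported on `insert j s` form a two-sided ideal. It
    -- is nonzero, so some relation has `j`-th coefficient `1`.
    obtain ⟨c, hc1, hc⟩ := one_mem_of_isSimpleRing
      (fun y : A => ∃ c : ι → A, c j = y ∧ ∑ i ∈ insert j s, l i • φ (c i) = 0)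
      ⟨0, rfl, by simp⟩
      (by
        rintro _ _ ⟨c, rfl, hc⟩ ⟨d, rfl, hd⟩
        exact ⟨c + d, rfl, by simp [smul_add, Finset.sum_add_distrib, hc, hd]⟩)
      (by
        rintro _ ⟨c, rfl, hc⟩
        exact ⟨-c, rfl, by simp [hc]⟩)
      (by
        rintro d _ ⟨c, rfl, hc⟩
        refine ⟨fun i => d * c i, rfl, ?_⟩
        simp only [map_mul, ← mul_smul_comm, ← Finset.mul_sum, hc, mul_zero])
      (by
        rintro d _ ⟨c, rfl, hc⟩
        refine ⟨fun i => c i * d, rfl, ?_⟩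
        simp only [map_mul, ← smul_mul_assoc, ← Finset.sum_mul, hc, zero_mul])
      ⟨a, rfl, ha⟩ haj
    -- Taking commutators of the normalised relation with `d` kills the `j`-th term, and the
    -- induction hypothesis kills the others. So all coefficients are central, and the relation
    -- already holds in `L`.
    have hcen : ∀ i ∈ insert j s, c i ∈ Subring.center A := by
      intro i hi
      rcases Finset.mem_insert.1 hi with rfl | hi
      · rw [hc1]; exact Subring.one_mem _
      refine Subring.mem_center_iff.2 fun d => sub_eq_zero.1 (ih (fun i => d * c i - c i * d) ?_ i hi)
      have hleft : ∑ i ∈ insert j s, l i • φ (d * c i) = 0 := by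
        simp only [map_mul, ← mul_smul_comm, ← Finset.mul_sum, hc, mul_zero]
      have hright : ∑ i ∈ insert j s, l i • φ (c i * d) = 0 := by
        simp only [map_mul, ← smul_mul_assoc, ← Finset.sum_mul, hc, zero_mul]
      have h1 : ∑ i ∈ insert j s, l i • φ (d * c i - c i * d) = 0 := by
        simp only [map_sub, smul_sub, Finset.sum_sub_distrib, hleft, hright, sub_zero]
      rwa [Finset.sum_insert hj, hc1, mul_one, one_mul, sub_self, map_zero, smul_zero,
        zero_add] at h1
    let z : ι → Subring.center A := fun i => if h : i ∈ insert j s then ⟨c i, hcen i h⟩ else 0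
    have hz : ∀ i ∈ insert j s, (z i : A) = c i := fun i hi => by simp only [z, dif_pos hi]
    have hsum : ∑ i ∈ insert j s, z i • l i = 0 := by
      refine (algebraMap L B).injective ?_
      rw [map_zero, ← hc, map_sum]
      refine Finset.sum_congr rfl fun i hi => ?_
      rw [← hz i hi, hφ, Algebra.smul_def, mul_comm, map_mul, ← Algebra.smul_def]
    have hzj := linearIndependent_iff'.1 hl _ z hsum j (Finset.mem_insert_self j s)
    have h1 : (1 : A) = 0 := by
      rw [← hc1, ← hz j (Finset.mem_insert_self j s), hzj]; rfl
    exact one_ne_zero h1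

/-- A ring homomorphism from a simple ring `A` to an algebra over an extension `L` of the centre
of `A`, whose image spans, identifies the scalar extension of `A` with the target. -/
theorem exists_algEquiv_of_span_range_eq_top (φ : A →+* B)
    (hφ : ∀ z : Subring.center A, φ z = algebraMap L B (algebraMap (Subring.center A) L z))
    (hspan : Submodule.span L (Set.range φ) = ⊤) :
    ∃ e : (L ⊗[Subring.center A] A) ≃ₐ[L] B, ∀ a, e (1 ⊗ₜ a) = φ a := by
  have : Module.Free (Subring.center A) L := by
    let := (IsSimpleRing.isField_center A).toField
    exact Module.Free.of_divisionRing _ _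
  let : Algebra (Subring.center A) B := Algebra.compHom B (algebraMap (Subring.center A) L)
  have : IsScalarTower (Subring.center A) L B := IsScalarTower.of_algebraMap_eq fun _ => rfl
  let φ' : A →ₐ[Subring.center A] B := { φ with commutes' := hφ }
  let Φ : (L ⊗[Subring.center A] A) →ₐ[L] B :=
    Algebra.TensorProduct.lift (Algebra.ofId L B) φ' fun x y => Algebra.commutes x (φ' y)
  have hΦ : ∀ l a, Φ (l ⊗ₜ a) = l • φ a := fun l a =>
    (Algebra.TensorProduct.lift_tmul _ _ _ _ _).trans (Algebra.smul_def _ _).symm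
  have hinj : Function.Injective Φ := by
    classical
    let b := Module.Free.chooseBasis (Subring.center A) L
    refine (injective_iff_map_eq_zero Φ).2 fun x hx => ?_
    obtain ⟨f, rfl⟩ := (TensorProduct.equivFinsuppOfBasisLeft b).symm.surjective x
    rw [TensorProduct.equivFinsuppOfBasisLeft_symm_apply, Finsupp.sum, map_sum] at hx
    simp_rw [hΦ] at hx
    have h0 := eq_zero_of_sum_smul_eq_zero φ hφ b b.linearIndependent f.support f hx
    have : f = 0 := by
      rw [← Finsupp.support_eq_empty, Finset.eq_empty_iff_forall_notMem]
      exact fun i hi => Finsupp.mem_support_iff.1 hi (h0 i hi)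
    rw [this, map_zero]
  have hsurj : Function.Surjective Φ := by
    rw [← AlgHom.coe_toLinearMap, ← LinearMap.range_eq_top, eq_top_iff, ← hspan,
      Submodule.span_le]
    rintro _ ⟨a, rfl⟩
    exact ⟨1 ⊗ₜ a, by rw [AlgHom.toLinearMap_apply, hΦ, one_smul]⟩
  exact ⟨AlgEquiv.ofBijective Φ ⟨hinj, hsurj⟩, fun a => (hΦ 1 a).trans (one_smul _ _)⟩

end CentralSimple

/-! ### The trace of an adjoint involution -/

section Trace

variable {L : Type*} [Field L]

/-- The trace of `X ↦ P Xᵀ Q`. -/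
theorem trace_mul_transpose_mul {m : Type*} [Fintype m] [DecidableEq m] (P Q : Matrix m m L)
    (S : Matrix m m L →ₗ[L] Matrix m m L) (hS : ∀ X, S X = P * X.transpose * Q) :
    LinearMap.trace L _ S = (P * Q.transpose).trace := by
  classical
  rw [LinearMap.trace_eq_matrix_trace L (Matrix.stdBasis L m m), Matrix.trace, Matrix.trace]
  simp only [Matrix.diag_apply, LinearMap.toMatrix_apply, hS, Matrix.mul_apply,
    Matrix.transpose_apply]
  rw [Fintype.sum_prod_type]
  -- The diagonal coefficient at the matrix unit `E_ij` is the `(i, j)` entry of `P E_ji Q`, which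
  -- is `P i j * Q i j`.
  refine Finset.sum_congr rfl fun i _ => Finset.sum_congr rfl fun j _ => ?_
  rw [Matrix.stdBasis_eq_single]
  have : ((Matrix.stdBasis L m m).repr (P * (Matrix.single i j (1 : L)).transpose * Q)) (i, j) =
      (P * (Matrix.single i j (1 : L)).transpose * Q) i j := rfl
  rw [this, Matrix.transpose_single, Matrix.mul_apply]
  simp [Matrix.mul_apply, Matrix.single_apply, ite_and]

variable {W : Type*} [AddCommGroup W] [Module L W] [FiniteDimensional L W]

/-- The trace of the adjoint involution of an `ε`-symmetric form on `W` is `ε dim W`. -/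
theorem trace_adjoint (β : LinearMap.BilinForm L W) (hβ : β.Nondegenerate) (ε : L)
    (hε : ∀ x y, β y x = ε * β x y) (S : Module.End L W →ₗ[L] Module.End L W)
    (hS : ∀ f x y, β x (f y) = β (S f x) y) :
    LinearMap.trace L _ S = ε * Module.finrank L W := by
  classical
  let e := Module.finBasis L W
  let J := LinearMap.BilinForm.toMatrix e β
  let M := LinearMap.toMatrixAlgEquiv e
  have hJ : IsUnit J.det :=
    isUnit_iff_ne_zero.2 ((LinearMap.BilinForm.nondegenerate_iff_det_ne_zero e).1 hβ)
  have hJT : J.transpose = ε • J := by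
    ext i j
    simp only [J, Matrix.transpose_apply, Matrix.smul_apply, LinearMap.BilinForm.toMatrix_apply]
    exact hε _ _
  have hM : ∀ f, J * M f = (M (S f)).transpose * J := by
    intro f
    have h1 := LinearMap.BilinForm.toMatrix_compRight e β f
    have h2 := LinearMap.BilinForm.toMatrix_compLeft e β (S f)
    have h3 : β.compRight f = β.compLeft (S f) := by
      ext x y
      exact hS f x y
    exact h1.symm.trans ((congrArg _ h3).trans h2)
  have hJ' : J = ε • J.transpose := by
    rw [← Matrix.transpose_smul, ← hJT, Matrix.transpose_transpose]
  -- In coordinates the adjoint is `X ↦ J⁻ᵀ Xᵀ Jᵀ`, with trace `tr(J⁻ᵀ J)`. The relation `J = ε Jᵀ`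
  -- turns this into `ε` times the dimension.
  have hS' : ∀ X, (M.toLinearEquiv.conj S) X = J⁻¹.transpose * X.transpose * J.transpose := by
    intro X
    obtain ⟨f, rfl⟩ := M.surjective X
    have h1 : M.toLinearEquiv.conj S (M f) = M (S f) := by
      rw [LinearEquiv.conj_apply_apply]
      exact congrArg (fun f => M (S f)) (M.symm_apply_apply f)
    rw [h1, ← Matrix.transpose_inj, Matrix.transpose_mul, Matrix.transpose_mul,
      Matrix.transpose_transpose, Matrix.transpose_transpose, Matrix.transpose_transpose,
      ← Matrix.mul_assoc, hM, Matrix.mul_nonsing_inv_cancel_right _ _ hJ]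
  rw [← LinearMap.trace_conj' S M.toLinearEquiv, trace_mul_transpose_mul _ _ _ hS',
    Matrix.transpose_transpose, hJ', Matrix.mul_smul, ← hJ', ← Matrix.transpose_mul,
    Matrix.mul_nonsing_inv _ hJ, Matrix.transpose_one, Matrix.trace_smul, Matrix.trace_one,
    Fintype.card_fin, smul_eq_mul]

end Trace

/-! ### The sign of a splitting and its independence of the splitting -/

section SplittingSign

variable {A : Type u} [Ring A] {σ : RingInvo A}

/-- An involution of the first kind, as a linear map over the centre. -/
def IsFirstKind.linearMap (hσ : IsFirstKind σ) : A →ₗ[Subring.center A] A where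
  toFun a := (σ a).unop
  map_add' a b := by rw [map_add, MulOpposite.unop_add]
  map_smul' z a := by
    rw [Subring.smul_def, smul_eq_mul, map_mul, MulOpposite.unop_mul, hσ z z.2,
      Subring.mem_center_iff.1 z.2]
    rfl

variable {L : Type u} [Field L] [Algebra (Subring.center A) L]
  {W : Type u} [AddCommGroup W] [Module L W]

theorem Splitting.adjoint' (s : Splitting σ L W) (a : A) (x y : W) :
    s.form (s.iso (1 ⊗ₜ a) x) y = s.form x (s.iso (1 ⊗ₜ (σ a).unop) y) := by
  rw [s.adjoint]
  exact congrArg (fun b => s.form (s.iso (1 ⊗ₜ b) x) y) (RingInvoClass.involution σ a).symm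

variable (A L) in
theorem algebraMap_center_injective [IsSimpleRing A] :
    Function.Injective (algebraMap (Subring.center A) L) := by
  let := (IsSimpleRing.isField_center A).toField
  exact (algebraMap (Subring.center A) L).injective

variable [FiniteDimensional L W]

/-- The form of a splitting is symmetric up to a sign. -/
theorem Splitting.exists_sign (s : Splitting σ L W) :
    ∃ ε : L, ε * ε = 1 ∧ ∀ x y, s.form y x = ε * s.form x y := by
  let θ : W ≃ₗ[L] Module.Dual L W := s.form.toDual s.nondegenerate
  -- `u` is the asymmetry of the form: `s.form (u x) y = s.form y x`. Since `σ` squares to the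
  -- identity, `u` commutes with the image of `A`, hence with all of `End W`, so it is a scalar.
  let u : Module.End L W := θ.symm.toLinearMap ∘ₗ s.form.flip
  have hu : ∀ x y, s.form (u x) y = s.form y x := fun x y =>
    LinearMap.BilinForm.apply_toDual_symm_apply (hB := s.nondegenerate) (s.form.flip x) y
  have hinj : ∀ x x', (∀ y, s.form x y = s.form x' y) → x = x' := fun x x' h =>
    θ.injective (LinearMap.ext h)
  have hcomm : ∀ t : L ⊗[Subring.center A] A, s.iso t * u = u * s.iso t := by
    intro t
    induction t with
    | zero => rw [map_zero, zero_mul, mul_zero]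
    | add t t' h h' => rw [map_add, add_mul, mul_add, h, h']
    | tmul l a =>
      have h1 : s.iso (1 ⊗ₜ a) * u = u * s.iso (1 ⊗ₜ a) := by
        ext x
        refine hinj _ _ fun y => ?_
        rw [Module.End.mul_apply, Module.End.mul_apply, hu, s.adjoint', hu, s.adjoint]
      have h2 : (l ⊗ₜ a : L ⊗[Subring.center A] A) = l • (1 ⊗ₜ a) := by
        rw [TensorProduct.smul_tmul', smul_eq_mul, mul_one]
      rw [h2, map_smul, smul_mul_assoc, mul_smul_comm, h1]
  have hcen : u ∈ Subalgebra.center L (Module.End L W) := by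
    refine Subalgebra.mem_center_iff.2 fun f => ?_
    obtain ⟨t, rfl⟩ := s.iso.surjective f
    exact hcomm t
  obtain ⟨c, hc⟩ := Algebra.IsCentral.mem_center_iff L |>.1 hcen
  have hc' : ∀ x y, s.form y x = c * s.form x y := fun x y => by
    rw [← hu, hc, Module.algebraMap_end_apply, map_smul, LinearMap.smul_apply, smul_eq_mul]
  by_cases h0 : ∃ x y, s.form x y ≠ 0
  · obtain ⟨x, y, hxy⟩ := h0
    refine ⟨c, mul_right_cancel₀ hxy ?_, hc'⟩
    rw [mul_assoc, ← hc', ← hc', one_mul]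
  · push Not at h0
    exact ⟨1, one_mul 1, fun x y => by rw [h0, h0, mul_zero]⟩

variable [IsSimpleRing A]

theorem free_over_center : Module.Free (Subring.center A) A := by
  let := (IsSimpleRing.isField_center A).toField
  exact Module.Free.of_divisionRing _ _

theorem Splitting.finrank_mul_self (s : Splitting σ L W) :
    Module.finrank L W * Module.finrank L W = Module.finrank (Subring.center A) A := by
  have := free_over_center (A := A)
  rw [← Module.finrank_linearMap L L W W, ← s.iso.toLinearEquiv.finrank_eq, Module.finrank_baseChange]

variable [Module.Finite (Subring.center A) A]

/-- Traces are stable under base change and conjugation, and `s.iso` turns `id ⊗ σ` into the adjoint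
involution, to which `trace_adjoint` applies. The left side does not involve the splitting, so the
sign becomes an invariant of `σ`. -/
theorem Splitting.algebraMap_trace (s : Splitting σ L W) (hσ : IsFirstKind σ) {ε : L}
    (hε : ∀ x y, s.form y x = ε * s.form x y) :
    algebraMap (Subring.center A) L (LinearMap.trace (Subring.center A) A hσ.linearMap) =
      ε * Module.finrank L W := by
  have := free_over_center (A := A)
  rw [← LinearMap.trace_baseChange, ← LinearMap.trace_conj' _ s.iso.toLinearEquiv]
  refine trace_adjoint s.form s.nondegenerate ε hε _ fun f x y => ?_
  obtain ⟨t, rfl⟩ := s.iso.surjective f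
  have h1 : s.iso.toLinearEquiv.conj (hσ.linearMap.baseChange L) (s.iso t) =
      s.iso (hσ.linearMap.baseChange L t) := by
    rw [LinearEquiv.conj_apply_apply]
    exact congrArg (fun t => s.iso (hσ.linearMap.baseChange L t)) (s.iso.symm_apply_apply t)
  rw [h1]
  clear h1
  induction t with
  | zero => simp only [map_zero, LinearMap.zero_apply]
  | add t t' h h' =>
    simp only [map_add, LinearMap.add_apply, h, h']
  | tmul l a =>
    have h2 : ∀ b : A, (l ⊗ₜ b : L ⊗[Subring.center A] A) = l • (1 ⊗ₜ b) := fun b => by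
      rw [TensorProduct.smul_tmul', smul_eq_mul, mul_one]
    rw [LinearMap.baseChange_tmul, h2, h2, map_smul, map_smul, LinearMap.smul_apply,
      LinearMap.smul_apply, map_smul, map_smul, LinearMap.smul_apply, s.adjoint]
    rfl

variable [CharZero (Subring.center A)]

/-- The sign of the form is the same for all splittings. -/
theorem Splitting.sign_eq {L' : Type u} [Field L'] [Algebra (Subring.center A) L']
    {W' : Type u} [AddCommGroup W'] [Module L' W'] [FiniteDimensional L' W']
    (s : Splitting σ L W) (s' : Splitting σ L' W') (hσ : IsFirstKind σ) (e : ℤ)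
    (he : ∀ x y, s.form y x = e * s.form x y) (x y : W') :
    s'.form y x = e * s'.form x y := by
  have := (IsSimpleRing.isField_center A).isDomain
  have : CharZero L' := charZero_of_injective_algebraMap (algebraMap_center_injective A L')
  have hdim : Module.finrank L W = Module.finrank L' W' :=
    Nat.mul_self_inj.1 (s.finrank_mul_self.trans s'.finrank_mul_self.symm)
  have hdim0 : (Module.finrank L' W' : L') ≠ 0 := by
    have := free_over_center (A := A)
    have h := s'.finrank_mul_self
    have h1 : 0 < Module.finrank (Subring.center A) A := Module.finrank_pos
    rw [← h] at h1
    exact Nat.cast_ne_zero.2 (Nat.pos_of_mul_pos_left h1).ne'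
  obtain ⟨ε, -, hε⟩ := s'.exists_sign
  -- Because `e` is an integer, the trace of `σ` over the centre can be evaluated from `s` and then
  -- compared in `L'` with its value from `s'`, where the dimension is the same and nonzero.
  have ht : LinearMap.trace (Subring.center A) A hσ.linearMap = e * Module.finrank L W := by
    refine algebraMap_center_injective A L ?_
    rw [s.algebraMap_trace hσ he, map_mul, map_intCast, map_natCast]
  have ht' := s'.algebraMap_trace hσ hε
  rw [ht, map_mul, map_intCast, map_natCast, hdim] at ht'
  rw [hε x y, mul_right_cancel₀ hdim0 ht']

theorem isSymplectic_of_splitting (s : Splitting σ L W) (hσ : IsFirstKind σ)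
    (hs : ∀ x y, s.form y x = - s.form x y) : IsSymplectic σ := by
  refine ⟨hσ, ⟨L, _, _, W, _, _, inferInstance, ⟨s⟩⟩, fun L' _ _ W' _ _ _ s' x => ?_⟩
  have : CharZero L' := charZero_of_injective_algebraMap (algebraMap_center_injective A L')
  have h := s.sign_eq s' hσ (-1) (fun x y => by rw [hs]; push_cast; ring) x x
  push_cast at h
  rw [neg_one_mul, eq_neg_iff_add_eq_zero, ← two_mul] at h
  exact (mul_eq_zero.1 h).resolve_left two_ne_zero

theorem isOrthogonal_of_splitting (s : Splitting σ L W) (hσ : IsFirstKind σ)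
    (hs : ∀ x y, s.form y x = s.form x y) : IsOrthogonal σ := by
  refine ⟨hσ, ⟨L, _, _, W, _, _, inferInstance, ⟨s⟩⟩, fun L' _ _ W' _ _ _ s' => ?_⟩
  have : CharZero L' := charZero_of_injective_algebraMap (algebraMap_center_injective A L')
  have h : ∀ x y, s'.form y x = s'.form x y := fun x y => by
    have h := s.sign_eq s' hσ 1 (fun x y => by rw [hs]; push_cast; ring) x y
    rwa [Int.cast_one, one_mul] at h
  refine ⟨⟨fun x y => h y x⟩, fun halt => ?_⟩
  -- A form that is both symmetric and alternating vanishes in characteristic zero. By nondegeneracy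
  -- `W' = 0`, contradicting `A ≠ 0`.
  have hzero : ∀ x y, s'.form x y = 0 := fun x y => by
    have h1 := halt.neg_eq y x
    rw [h, neg_eq_iff_add_eq_zero, ← two_mul] at h1
    exact (mul_eq_zero.1 h1).resolve_left two_ne_zero
  have hsub : ∀ x : W', x = 0 := fun x => s'.nondegenerate.1 x (hzero x)
  have : Subsingleton W' := ⟨fun x y => (hsub x).trans (hsub y).symm⟩
  have := free_over_center (A := A)
  have := (IsSimpleRing.isField_center A).isDomain
  have h1 : 0 < Module.finrank (Subring.center A) A := Module.finrank_pos
  rw [← s'.finrank_mul_self, Module.finrank_zero_of_subsingleton] at h1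
  exact lt_irrefl _ h1

end SplittingSign

/-! ### Self-duality over `ℚ` and simplicity of the endomorphism algebra -/

section Rational

variable {G : Type w} [Group G] [Finite G] {U : Type u} [AddCommGroup U] [Module ℚ U]
  [FiniteDimensional ℚ U]

/-- Rational representations of finite groups are self-dual. -/
theorem nonempty_equiv_dual (ρ : Representation ℚ G U) : Nonempty (ρ.Equiv ρ.dual) := by
  have := Fintype.ofFinite G
  let b := Module.finBasis ℚ U
  -- The sum of squares in a basis, summed over `G`. It is invariant, and it is positive definite
  -- because `ℚ` is ordered and the term at `g = 1` is already definite.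
  let B : U →ₗ[ℚ] Module.Dual ℚ U :=
    LinearMap.mk₂ ℚ (fun x y => ∑ g, ∑ i, b.repr (ρ g x) i * b.repr (ρ g y) i)
      (by intros; simp [add_mul, Finset.sum_add_distrib])
      (by intros; simp [mul_assoc, Finset.mul_sum])
      (by intros; simp [mul_add, Finset.sum_add_distrib])
      (by intros; simp [mul_left_comm, Finset.mul_sum])
  have hB : ∀ x y, B x y = ∑ g, ∑ i, b.repr (ρ g x) i * b.repr (ρ g y) i := fun _ _ => rfl
  have hinj : Function.Injective B := by
    refine (injective_iff_map_eq_zero B).2 fun x hx => ?_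
    have h := LinearMap.congr_fun hx x
    rw [hB, LinearMap.zero_apply, Finset.sum_eq_zero_iff_of_nonneg
      fun _ _ => Finset.sum_nonneg fun _ _ => mul_self_nonneg _] at h
    have h1 := h 1 (Finset.mem_univ _)
    rw [Finset.sum_eq_zero_iff_of_nonneg fun _ _ => mul_self_nonneg _] at h1
    refine b.repr.map_eq_zero_iff.1 (Finsupp.ext fun i => ?_)
    have h2 := h1 i (Finset.mem_univ _)
    rw [map_one, Module.End.one_apply] at h2
    exact mul_self_eq_zero.1 h2
  let f : ρ.IntertwiningMap ρ.dual := ⟨B, fun g => by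
    ext x y
    rw [LinearMap.comp_apply, LinearMap.comp_apply, Representation.dual_apply,
      Module.Dual.transpose_apply, LinearMap.comp_apply, hB, hB]
    refine Fintype.sum_equiv (Equiv.mulRight g) _ _ fun h => ?_
    simp only [Equiv.coe_mulRight, map_mul, Module.End.mul_apply,
      Representation.self_inv_apply]⟩
  exact ⟨f.ofBijective ⟨hinj, (LinearMap.injective_iff_surjective_of_finrank_eq_finrank
    Subspace.dual_finrank_eq.symm).1 hinj⟩⟩

/-- As `ρ ≅ ρ*`, the doubled representation is `2n` copies of `ρ`. Its endomorphism ring is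
therefore a matrix ring over `End_G(ρ)`, which is a division ring by Schur's lemma. -/
theorem isSimpleRing_endG (ρ : Representation ℚ G U) (hρ : ρ.IsIrreducible) (n : ℕ)
    (hn : 1 ≤ n) : IsSimpleRing (EndG (doubled (power ρ n))) := by
  classical
  obtain ⟨e⟩ := nonempty_equiv_dual ρ
  have : NeZero n := ⟨by omega⟩
  -- The `2n` coordinates: the components of a vector in `ρⁿ`, and the restrictions of a functional
  -- to the summands, carried back to `ρ` by the inverse of `e`.
  let p : Fin n ⊕ Fin n → (doubled (power ρ n)).IntertwiningMap ρ := Sum.elim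
    (fun i => ⟨LinearMap.proj i ∘ₗ LinearMap.fst ℚ _ _, fun g => rfl⟩)
    (fun i => e.symm.toIntertwiningMap.comp
      ⟨Module.Dual.transpose (LinearMap.single ℚ (fun _ => U) i) ∘ₗ LinearMap.snd ℚ _ _, fun g => by
        refine LinearMap.ext fun x => LinearMap.ext fun y => ?_
        change x.2 ((ρ g⁻¹).compLeft (Fin n) (Pi.single i y)) = x.2 (Pi.single i (ρ g⁻¹ y))
        congr 1
        ext j
        exact (Pi.apply_single (fun _ => ρ g⁻¹) (fun _ => map_zero _) i y j)⟩)
  let P : (doubled (power ρ n)).asModule →ₗ[MonoidAlgebra ℚ G] (Fin n ⊕ Fin n → ρ.asModule) :=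
    LinearMap.pi fun i => Representation.IntertwiningMap.equivLinearMapAsModule _ _ (p i)
  have hP : Function.Bijective P := by
    have hinl : ∀ x i, P x (Sum.inl i) = x.1 i := fun _ _ => rfl
    have hinr : ∀ x i, P x (Sum.inr i) = e.symm (x.2 ∘ₗ LinearMap.single ℚ (fun _ => U) i) :=
      fun _ _ => rfl
    refine ⟨(injective_iff_map_eq_zero P).2 fun x hx => Prod.ext ?_ ?_, fun y => ?_⟩
    · ext i
      exact (hinl x i).symm.trans (congrFun hx (Sum.inl i))
    · refine LinearMap.pi_ext' fun i => ?_
      have h := (hinr x i).symm.trans (congrFun hx (Sum.inr i))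
      have h' := congrArg e h
      rw [e.apply_symm_apply] at h'
      exact h'.trans ((map_zero e).trans (LinearMap.zero_comp _).symm)
    · let η : Module.Dual ℚ (Fin n → U) := ∑ i, (e (y (Sum.inr i))) ∘ₗ LinearMap.proj i
      refine ⟨(fun i => y (Sum.inl i), η), funext fun i => ?_⟩
      rcases i with i | i
      · rfl
      · refine (hinr _ i).trans ?_
        have h : η ∘ₗ LinearMap.single ℚ (fun _ => U) i = e (y (Sum.inr i)) := by
          refine LinearMap.ext fun u => ?_
          simp only [η, LinearMap.comp_apply, LinearMap.sum_apply, LinearMap.coe_single,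
            LinearMap.proj_apply]
          rw [Finset.sum_eq_single i, Pi.single_eq_same]
          · intro j _ hj
            rw [Pi.single_eq_of_ne hj]
            exact map_zero (e (y (Sum.inr j)))
          · exact fun h => absurd (Finset.mem_univ i) h
        exact (congrArg e.symm h).trans (e.symm_apply_apply _)
  let E := LinearEquiv.ofBijective P hP
  let R : EndG (doubled (power ρ n)) ≃+*
      Matrix (Fin n ⊕ Fin n) (Fin n ⊕ Fin n) (Module.End (MonoidAlgebra ℚ G) ρ.asModule) :=
    (Representation.IntertwiningMap.equivAlgEnd (doubled (power ρ n))).toRingEquiv.trans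
      ((LinearEquiv.conjRingEquiv E).trans (endVecRingEquivMatrixEnd _ _ _))
  exact IsSimpleRing.of_ringEquiv R.symm inferInstance

end Rational

/-! ### Class sums and involutions of the second kind -/

section ClassSum

variable {K : Type v} [Field K] {G : Type w} [Group G] [Fintype G]
  {V : Type u} [AddCommGroup V] [Module K V]

/-- The operator by which (a multiple of) the sum of the conjugates of `x` acts. -/
def classSum (π : Representation K G V) (x : G) : Module.End K V := ∑ g, π (g * x * g⁻¹)

theorem classSum_comm (π : Representation K G V) (x h : G) :
    classSum π x * π h = π h * classSum π x := by
  rw [classSum, Finset.sum_mul, Finset.mul_sum]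
  refine Fintype.sum_equiv (Equiv.mulLeft h⁻¹) _ _ fun g => ?_
  rw [← map_mul, ← map_mul, Equiv.coe_mulLeft]
  congr 1
  group

theorem map_classSum {V' : Type*} [AddCommGroup V'] [Module K V'] {π : Representation K G V}
    {π' : Representation K G V'} (f : π.IntertwiningMap π') (x : G) (v : V) :
    f (classSum π x v) = classSum π' x (f v) := by
  simp only [classSum, LinearMap.sum_apply, map_sum, f.isIntertwining]

theorem trace_classSum [FiniteDimensional K V] (π : Representation K G V) (x : G) :
    LinearMap.trace K V (classSum π x) = Fintype.card G * π.character x := by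
  have h : ∀ g, LinearMap.trace K V (π (g * x * g⁻¹)) = π.character x := fun g => π.char_conj x g
  rw [classSum, map_sum, Finset.sum_congr rfl fun g _ => h g, Finset.sum_const, Finset.card_univ,
    nsmul_eq_mul]

/-- The class sum, as an element of `End_G(V)`. -/
def classSumG (π : Representation K G V) (x : G) : EndG π where
  toLinearMap := classSum π x
  isIntertwining' h := classSum_comm π x h

theorem classSumG_mem_center (π : Representation K G V) (x : G) :
    classSumG π x ∈ Subring.center (EndG π) := by
  refine Subring.mem_center_iff.2 fun f => ?_
  refine Representation.IntertwiningMap.ext (LinearMap.ext fun v => ?_)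
  exact map_classSum f x v

/-- Invariance of the form means that the adjoint of the action of `g` is the action of `g⁻¹`, and
inversion maps conjugates of `x` to conjugates of `x⁻¹`. -/
theorem tildeSigma_classSumG [FiniteDimensional K V] (π : Representation K G V) (x : G) :
    (tildeSigma π (classSumG (doubled π) x)).unop = classSumG (doubled π) x⁻¹ := by
  refine Representation.IntertwiningMap.ext (eq_adjointMap fun v w => ?_).symm
  change dualityForm K V (classSum (doubled π) x⁻¹ v) w =
    dualityForm K V v (classSum (doubled π) x w)
  simp only [classSum, LinearMap.sum_apply, map_sum]
  refine Finset.sum_congr rfl fun g _ => ?_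
  rw [dualityForm_move]
  congr 3
  group

theorem classSum_complexify {U : Type u} [AddCommGroup U] [Module ℚ U] (ρ : Representation ℚ G U)
    (x : G) : classSum (complexify ρ) x = (classSum ρ x).baseChange ℂ := by
  ext v
  simp [classSum, complexify, TensorProduct.tmul_sum]

/-- Under the hypothesis `τ` and its dual have the same character, so orthogonality gives `dim
Hom_G(τ, τ*) = dim Hom_G(τ, τ) = 1`. A nonzero intertwiner is injective, and bijective by dimension.
-/
theorem isSelfDual_of_character_eq {T : Type*} [AddCommGroup T] [Module ℂ T]
    [FiniteDimensional ℂ T] (τ : Representation ℂ G T) (hτ : τ.IsIrreducible)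
    (h : ∀ x, τ.character x = τ.character x⁻¹) : IsSelfDual τ := by
  have : Invertible (Nat.card G : ℂ) := invertibleOfNonzero (Nat.cast_ne_zero.2 Nat.card_pos.ne')
  have h1 := Representation.card_inv_mul_sum_char_mul_char_eq_finrank τ τ.dual
  simp_rw [Representation.char_dual, ← h] at h1
  have h2 := Representation.card_inv_mul_sum_char_mul_char_eq_finrank τ τ
  simp_rw [← h] at h2
  rw [h2, Representation.IsIrreducible.finrank_intertwiningMap_self] at h1
  have h3 : 0 < Module.finrank ℂ (τ.IntertwiningMap τ.dual) := by
    have : Module.finrank ℂ (τ.IntertwiningMap τ.dual) = 1 := by exact_mod_cast h1.symm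
    omega
  have := Module.nontrivial_of_finrank_pos h3
  obtain ⟨f, hf⟩ := exists_ne (0 : τ.IntertwiningMap τ.dual)
  have hinj := (Representation.IsIrreducible.injective_or_eq_zero f).resolve_right hf
  exact ⟨f.ofBijective ⟨hinj, (LinearMap.injective_iff_surjective_of_finrank_eq_finrank
    (f := f.toLinearMap) Subspace.dual_finrank_eq.symm).1 hinj⟩⟩

end ClassSum

/-- If `σ` were trivial on the centre, the class sums of `x` and `x⁻¹` would coincide on the doubled
representation. Equivariant maps commute with class sums, which passes the equality to `ρ` by
projection and to `τ` by the embedding; traces then compare characters. -/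
theorem isSecondKind_of_not_isSelfDual {G : Type w} [Group G] [Finite G] {U : Type u}
    [AddCommGroup U] [Module ℚ U] [FiniteDimensional ℚ U] (ρ : Representation ℚ G U) (n : ℕ)
    (hn : 1 ≤ n) {T : Type*} [AddCommGroup T] [Module ℂ T] [FiniteDimensional ℂ T]
    (τ : Representation ℂ G T) (hτ : IsIrreducibleConstituent τ (complexify ρ))
    (hdual : ¬ IsSelfDual τ) : IsSecondKind (tildeSigma (power ρ n)) := by
  have := Fintype.ofFinite G
  by_contra hσ
  simp only [IsSecondKind, not_exists, not_and, not_not] at hσ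
  obtain ⟨hirr, f, hf⟩ := hτ
  refine hdual (isSelfDual_of_character_eq τ hirr fun x => ?_)
  have hM := congrArg (fun f : EndG (doubled (power ρ n)) => f.toLinearMap)
    (hσ _ (classSumG_mem_center (doubled (power ρ n)) x))
  rw [tildeSigma_classSumG] at hM
  have hU : classSum ρ x = classSum ρ x⁻¹ := by
    ext u
    let p : (doubled (power ρ n)).IntertwiningMap ρ :=
      ⟨LinearMap.proj ⟨0, hn⟩ ∘ₗ LinearMap.fst ℚ _ _, fun g => rfl⟩
    have h : ∀ y, p (classSum (doubled (power ρ n)) y (fun _ => u, 0)) = classSum ρ y u :=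
      fun y => map_classSum p y _
    rw [← h, ← h]
    exact congrArg p (LinearMap.congr_fun hM _).symm
  have hT : classSum τ x = classSum τ x⁻¹ := by
    ext t
    refine hf ?_
    rw [map_classSum, map_classSum, classSum_complexify, classSum_complexify, hU]
  have h := congrArg (LinearMap.trace ℂ T) hT
  rw [trace_classSum, trace_classSum] at h
  exact mul_left_cancel₀ (Nat.cast_ne_zero.2 Fintype.card_ne_zero) h

/-! ### Descent of equivariant operators from `ℂ` to `ℚ` -/

section Complexification

variable {M : Type u} [AddCommGroup M] [Module ℚ M] [FiniteDimensional ℚ M]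

theorem baseChange_nondegenerate {B : LinearMap.BilinForm ℚ M} (hB : B.Nondegenerate) :
    (LinearMap.BilinForm.baseChange ℂ B).Nondegenerate := by
  classical
  let b := Module.finBasis ℚ M
  rw [LinearMap.BilinForm.nondegenerate_iff_det_ne_zero (b.baseChange ℂ)]
  have h : LinearMap.BilinForm.toMatrix (b.baseChange ℂ) (LinearMap.BilinForm.baseChange ℂ B) =
      (algebraMap ℚ ℂ).mapMatrix (LinearMap.BilinForm.toMatrix b B) := by
    ext i j
    simp [LinearMap.BilinForm.toMatrix_apply]
  rw [h, ← RingHom.map_det]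
  exact (map_ne_zero _).2 ((LinearMap.BilinForm.nondegenerate_iff_det_ne_zero b).1 hB)

/-- With respect to a rational basis, the matrix units are base changes of rational operators. -/
theorem span_range_baseChange_eq_top :
    Submodule.span ℂ (Set.range fun f : Module.End ℚ M => f.baseChange ℂ) = ⊤ := by
  classical
  let b := Module.finBasis ℚ M
  let c := b.baseChange ℂ
  refine eq_top_iff.2 fun Θ _ => ?_
  have hΘ : Θ = ∑ i, ∑ j, c.repr (Θ (c j)) i •
      ((b.coord j).smulRight (b i) : Module.End ℚ M).baseChange ℂ := by
    refine c.ext fun k => ?_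
    have hk : ∀ i j, ((b.coord j).smulRight (b i) : Module.End ℚ M).baseChange ℂ (c k) =
        if j = k then c i else 0 := by
      intro i j
      rw [Module.Basis.baseChange_apply, Module.Basis.baseChange_apply, LinearMap.baseChange_tmul,
        LinearMap.smulRight_apply, Module.Basis.coord_apply, Module.Basis.repr_self,
        Finsupp.single_apply]
      by_cases h : k = j
      · rw [if_pos h, if_pos h.symm, one_smul]
      · rw [if_neg h, if_neg (Ne.symm h), zero_smul, TensorProduct.tmul_zero]
    simp only [LinearMap.sum_apply, LinearMap.smul_apply, hk, smul_ite, smul_zero,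
      Finset.sum_ite_eq', Finset.mem_univ, if_true]
    exact (c.sum_repr _).symm
  rw [hΘ]
  exact Submodule.sum_mem _ fun i _ => Submodule.sum_mem _ fun j _ =>
    Submodule.smul_mem _ _ (Submodule.subset_span ⟨_, rfl⟩)

variable {G : Type w} [Group G] (π : Representation ℚ G M)

omit [FiniteDimensional ℚ M] in
@[simp]
theorem complexify_tmul (g : G) (z : ℂ) (x : M) : complexify π g (z ⊗ₜ x) = z ⊗ₜ π g x := rfl

/-- Equivariant endomorphisms of the complexification are complex combinations of rational
equivariant endomorphisms. -/
theorem mem_span_of_commute [Finite G] (Θ : Module.End ℂ (ℂ ⊗[ℚ] M))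
    (hΘ : ∀ g, Θ * complexify π g = complexify π g * Θ) :
    Θ ∈ Submodule.span ℂ (Set.range fun f : EndG π => f.toLinearMap.baseChange ℂ) := by
  have := Fintype.ofFinite G
  -- Summing conjugates over `G` turns rational operators into rational equivariant ones, while it
  -- multiplies the equivariant `Θ` by the order of `G`, which is invertible.
  have key : ∀ f : Module.End ℂ (ℂ ⊗[ℚ] M),
      ∑ g, complexify π g * f * complexify π g⁻¹ ∈
        Submodule.span ℂ (Set.range fun f : EndG π => f.toLinearMap.baseChange ℂ) := by
    intro f
    have hf : f ∈ Submodule.span ℂ (Set.range fun f : Module.End ℚ M => f.baseChange ℂ) := by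
      rw [span_range_baseChange_eq_top]; trivial
    induction hf using Submodule.span_induction with
    | mem f hf =>
      obtain ⟨f, rfl⟩ := hf
      refine Submodule.subset_span ⟨⟨∑ g, π g * f * π g⁻¹, fun h => ?_⟩, ?_⟩
      · change (∑ g, π g * f * π g⁻¹) * π h = π h * ∑ g, π g * f * π g⁻¹
        rw [Finset.sum_mul, Finset.mul_sum]
        refine Fintype.sum_equiv (Equiv.mulLeft h⁻¹) _ _ fun g => ?_
        simp only [Equiv.coe_mulLeft, mul_inv_rev, inv_inv, map_mul, ← mul_assoc]
        rw [← map_mul π h h⁻¹, mul_inv_cancel, map_one, one_mul]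
      · refine TensorProduct.AlgebraTensorModule.ext fun z x => ?_
        simp [LinearMap.sum_apply, TensorProduct.tmul_sum]
    | zero => simp
    | add f f' _ _ h h' =>
      simp only [mul_add, add_mul, Finset.sum_add_distrib]
      exact Submodule.add_mem _ h h'
    | smul c f _ h =>
      simp only [mul_smul_comm, smul_mul_assoc, ← Finset.smul_sum]
      exact Submodule.smul_mem _ _ h
  have h := key Θ
  have h1 : ∀ g, complexify π g * Θ * complexify π g⁻¹ = Θ := fun g => by
    rw [← hΘ, mul_assoc, ← map_mul, mul_inv_cancel, map_one, mul_one]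
  rw [Finset.sum_congr rfl fun g _ => h1 g, Finset.sum_const, Finset.card_univ,
    ← Nat.cast_smul_eq_nsmul ℂ] at h
  exact (Submodule.smul_mem_iff _ (Nat.cast_ne_zero.2 Fintype.card_ne_zero)).1 h

end Complexification

/-! ### The complexified duality form -/

section ComplexForm

variable {V : Type u} [AddCommGroup V] [Module ℚ V]

variable (V) in
/-- The complexification of the duality form. -/
def complexForm : LinearMap.BilinForm ℂ (ℂ ⊗[ℚ] (V × Module.Dual ℚ V)) :=
  LinearMap.BilinForm.baseChange ℂ (dualityForm ℚ V)

theorem complexForm_nondegenerate [FiniteDimensional ℚ V] : (complexForm V).Nondegenerate :=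
  baseChange_nondegenerate dualityForm_nondegenerate

theorem complexForm_adjoint (f g : Module.End ℚ (V × Module.Dual ℚ V))
    (h : ∀ x y, dualityForm ℚ V (g x) y = dualityForm ℚ V x (f y))
    (x y : ℂ ⊗[ℚ] (V × Module.Dual ℚ V)) :
    complexForm V (g.baseChange ℂ x) y = complexForm V x (f.baseChange ℂ y) := by
  induction x with
  | zero => simp only [map_zero, LinearMap.zero_apply]
  | add x x' hx hx' => simp only [map_add, LinearMap.add_apply, hx, hx']
  | tmul z x =>
    induction y with
    | zero => simp only [map_zero]
    | add y y' hy hy' => simp only [map_add, hy, hy']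
    | tmul z' y =>
      rw [LinearMap.baseChange_tmul, LinearMap.baseChange_tmul, complexForm,
        LinearMap.BilinForm.baseChange_tmul, LinearMap.BilinForm.baseChange_tmul, h]

theorem complexForm_comm (x y : ℂ ⊗[ℚ] (V × Module.Dual ℚ V)) :
    complexForm V x y = complexForm V y x :=
  (LinearMap.BilinForm.IsSymm.baseChange ℂ ⟨dualityForm_comm⟩).eq x y

variable {G : Type w} [Group G] (ρ : Representation ℚ G V)

theorem complexForm_move (g : G) (x y : ℂ ⊗[ℚ] (V × Module.Dual ℚ V)) :
    complexForm V (complexify (doubled ρ) g x) y =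
      complexForm V x (complexify (doubled ρ) g⁻¹ y) :=
  complexForm_adjoint _ _ (dualityForm_move ρ g) x y

theorem complexForm_invariant (g : G) (x y : ℂ ⊗[ℚ] (V × Module.Dual ℚ V)) :
    complexForm V (complexify (doubled ρ) g x) (complexify (doubled ρ) g y) =
      complexForm V x y := by
  rw [complexForm_move, Representation.inv_self_apply]

end ComplexForm

/-! ### Uniqueness of invariant forms -/

section InvariantForms

variable {G : Type w} [Group G] {T : Type v} [AddCommGroup T] [Module ℂ T]
  [FiniteDimensional ℂ T] {τ : Representation ℂ G T}

/-- Invariant bilinear forms on an irreducible representation are proportional. -/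
theorem exists_eq_mul_of_invariant (hτ : τ.IsIrreducible) {c : LinearMap.BilinForm ℂ T}
    (hc : c.Nondegenerate) (hinv : ∀ g s t, c (τ g s) (τ g t) = c s t)
    (d : LinearMap.BilinForm ℂ T) (hd : ∀ g s t, d (τ g s) (τ g t) = d s t) :
    ∃ z : ℂ, ∀ s t, d s t = z * c s t := by
  let θ : T ≃ₗ[ℂ] Module.Dual ℂ T := c.toDual hc
  have hθ : ∀ s t, c (θ.symm (d s)) t = d s t := fun s t =>
    LinearMap.BilinForm.apply_toDual_symm_apply (hB := hc) (d s) t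
  -- Nondegeneracy of `c` lets one write `d s t = c (f s) t`. Invariance of both forms makes `f`
  -- equivariant, so Schur's lemma makes it a scalar.
  let f : τ.IntertwiningMap τ := ⟨θ.symm.toLinearMap ∘ₗ d, fun g => by
    ext s
    refine θ.injective (LinearMap.ext fun t => ?_)
    change c (θ.symm (d (τ g s))) t = c (τ g (θ.symm (d s))) t
    rw [hθ, ← Representation.self_inv_apply τ g t, hinv, hd, hθ]⟩
  obtain ⟨z, hz⟩ :=
    (Representation.IsIrreducible.algebraMap_intertwiningMap_bijective_of_isAlgClosed
      (ρ := τ)).surjective f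
  refine ⟨z, fun s t => ?_⟩
  have h : θ.symm (d s) = z • s := by
    have := congrArg (fun f : τ.IntertwiningMap τ => f s) hz
    exact this.symm
  rw [← hθ, h, map_smul, LinearMap.smul_apply, smul_eq_mul]

end InvariantForms

/-- The operators of rank one span the endomorphism algebra. -/
theorem eq_top_of_rank_one_mem {L : Type*} [Field L] {H : Type*} [AddCommGroup H] [Module L H]
    [FiniteDimensional L H] {β : LinearMap.BilinForm L H} (hβn : β.Nondegenerate)
    (P : Submodule L (Module.End L H)) (hP : ∀ h₁ h₂, (β h₂).smulRight h₁ ∈ P) : P = ⊤ := by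
  classical
  refine eq_top_iff.2 fun f _ => ?_
  let e := Module.finBasis L H
  -- Each coordinate functional is `β` of some vector, so the expansion of `f` in a basis is a sum
  -- of the given rank one operators.
  have hf : f = ∑ i, (β ((β.toDual hβn).symm (e.coord i))).smulRight (f (e i)) := by
    refine e.ext fun j => ?_
    rw [LinearMap.sum_apply]
    simp only [LinearMap.smulRight_apply, LinearMap.BilinForm.apply_toDual_symm_apply,
      Module.Basis.coord_apply, Module.Basis.repr_self, Finsupp.single_apply, ite_smul, one_smul,
      zero_smul, Finset.sum_ite_eq, Finset.mem_univ, if_true]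
  rw [hf]
  exact Submodule.sum_mem _ fun i _ => hP _ _

/-! ### The multiplicity space, its algebra action and its form -/

section MultiplicitySpace

variable {G : Type w} [Group G] {T : Type v} [AddCommGroup T] [Module ℂ T]
  (τ : Representation ℂ G T)

/-- The multiplicity space `Hom_G(τ, ℂ ⊗ π)`. -/
def multSpace {M : Type u} [AddCommGroup M] [Module ℚ M] (π : Representation ℚ G M) :
    Submodule ℂ (T →ₗ[ℂ] ℂ ⊗[ℚ] M) where
  carrier := {h | ∀ g t, h (τ g t) = complexify π g (h t)}
  add_mem' h h' g t := by rw [LinearMap.add_apply, LinearMap.add_apply, h, h', map_add]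
  zero_mem' g t := by rw [LinearMap.zero_apply, LinearMap.zero_apply, map_zero]
  smul_mem' z h hh g t := by rw [LinearMap.smul_apply, LinearMap.smul_apply, hh, map_smul]

/-- The multiplicity space `Hom_G(τ, ℂ ⊗ π)`, as a type. -/
def MultSpace {M : Type u} [AddCommGroup M] [Module ℚ M] (π : Representation ℚ G M) :
    Type max u v := multSpace τ π

section

variable {M : Type u} [AddCommGroup M] [Module ℚ M] (π : Representation ℚ G M)

instance : AddCommGroup (MultSpace τ π) := inferInstanceAs (AddCommGroup (multSpace τ π))

instance : Module ℂ (MultSpace τ π) := inferInstanceAs (Module ℂ (multSpace τ π))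

instance [FiniteDimensional ℂ T] [FiniteDimensional ℚ M] :
    FiniteDimensional ℂ (MultSpace τ π) :=
  FiniteDimensional.finiteDimensional_submodule (multSpace τ π)

end

/-- The action of `End_G(π)` on the multiplicity space. -/
def multAction {M : Type u} [AddCommGroup M] [Module ℚ M] (π : Representation ℚ G M) :
    EndG π →+* Module.End ℂ (MultSpace τ π) where
  toFun a :=
    { toFun h := ⟨a.toLinearMap.baseChange ℂ ∘ₗ h.1, fun g t => by
        rw [LinearMap.comp_apply, LinearMap.comp_apply, h.2]
        have h1 : a.toLinearMap.baseChange ℂ ∘ₗ complexify π g =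
            complexify π g ∘ₗ a.toLinearMap.baseChange ℂ := by
          refine TensorProduct.AlgebraTensorModule.ext fun z x => ?_
          exact congrArg (z ⊗ₜ[ℚ] ·) (LinearMap.congr_fun (a.isIntertwining' g) x)
        exact LinearMap.congr_fun h1 (h.1 t)⟩
      map_add' h h' := Subtype.ext (LinearMap.comp_add _ _ _)
      map_smul' z h := Subtype.ext (LinearMap.comp_smul _ _ _) }
  map_one' := by
    refine LinearMap.ext fun h => Subtype.ext ?_
    exact (congrArg (· ∘ₗ h.1) LinearMap.baseChange_id).trans (LinearMap.id_comp _)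
  map_mul' a b := by
    refine LinearMap.ext fun h => Subtype.ext ?_
    exact congrArg (· ∘ₗ h.1) (LinearMap.baseChange_comp b.toLinearMap a.toLinearMap)
  map_zero' := by
    refine LinearMap.ext fun h => Subtype.ext ?_
    exact (congrArg (· ∘ₗ h.1) (LinearMap.baseChange_zero)).trans (LinearMap.zero_comp _)
  map_add' a b := by
    refine LinearMap.ext fun h => Subtype.ext ?_
    exact (congrArg (· ∘ₗ h.1) (LinearMap.baseChange_add a.toLinearMap b.toLinearMap)).trans
      (LinearMap.add_comp _ _ _)

theorem multAction_apply {M : Type u} [AddCommGroup M] [Module ℚ M] (π : Representation ℚ G M)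
    (a : EndG π) (h : MultSpace τ π) (t : T) :
    (multAction τ π a h).1 t = a.toLinearMap.baseChange ℂ (h.1 t) := rfl

theorem exists_apply_ne_zero [Nontrivial T] {c : LinearMap.BilinForm ℂ T} (hc : c.Nondegenerate) :
    ∃ s t, c s t ≠ 0 := by
  obtain ⟨s, hs⟩ := exists_ne (0 : T)
  by_contra! h
  exact hs (hc.1 s (h s))

variable {τ} in
-- A nonzero map onto an irreducible is surjective, and Maschke's theorem splits it.
theorem exists_section [Finite G] (hτ : τ.IsIrreducible) {M : Type u} [AddCommGroup M]
    [Module ℚ M] (π : Representation ℚ G M) (k : (complexify π).IntertwiningMap τ)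
    (hk : k ≠ 0) : ∃ h : MultSpace τ π, ∀ t, k (h.1 t) = t := by
  have := Fintype.ofFinite G
  have : NeZero (Nat.card G : ℂ) := ⟨Nat.cast_ne_zero.2 Nat.card_pos.ne'⟩
  have hsurj := (Representation.IsIrreducible.surjective_or_eq_zero k).resolve_right hk
  obtain ⟨h, hh⟩ := IsSemisimpleModule.lifting_property
    (Representation.IntertwiningMap.equivLinearMapAsModule _ _ k) hsurj LinearMap.id
  let h' := (Representation.IntertwiningMap.equivLinearMapAsModule τ (complexify π)).symm h
  exact ⟨⟨h'.toLinearMap, h'.isIntertwining⟩, LinearMap.congr_fun hh⟩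

variable [FiniteDimensional ℂ T] {τ}
  {V : Type u} [AddCommGroup V] [Module ℚ V] (ρ : Representation ℚ G V)

/-- `k` is the adjoint of `h` for the forms `c` and `complexForm`, equivariant because both are
invariant. It serves for the nondegeneracy of `β` and for producing rank one operators. -/
theorem exists_adjoint {c : LinearMap.BilinForm ℂ T} (hc : c.Nondegenerate)
    (hinv : ∀ g s t, c (τ g s) (τ g t) = c s t) (h : MultSpace τ (doubled ρ)) :
    ∃ k : (complexify (doubled ρ)).IntertwiningMap τ,
      ∀ s x, c s (k x) = complexForm V (h.1 s) x := by
  let θ : T ≃ₗ[ℂ] Module.Dual ℂ T := c.flip.toDual hc.flip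
  have hθ : ∀ (η : Module.Dual ℂ T) s, c s (θ.symm η) = η s := fun η s =>
    LinearMap.BilinForm.apply_toDual_symm_apply (hB := hc.flip) η s
  let k : (ℂ ⊗[ℚ] (V × Module.Dual ℚ V)) →ₗ[ℂ] T :=
    θ.symm.toLinearMap ∘ₗ ((complexForm V).flip.compl₂ h.1)
  have hk : ∀ s x, c s (k x) = complexForm V (h.1 s) x := fun s x => hθ _ s
  refine ⟨⟨k, fun g => LinearMap.ext fun x => θ.injective (LinearMap.ext fun s => ?_)⟩, hk⟩
  change c s (k (complexify (doubled ρ) g x)) = c s (τ g (k x))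
  rw [← Representation.self_inv_apply τ g s, hinv, hk, hk, h.2, complexForm_invariant]

/-- The form on the multiplicity space which is induced by the invariant form on `τ`. -/
theorem exists_multForm [Nontrivial T] (hτ : τ.IsIrreducible) {c : LinearMap.BilinForm ℂ T}
    (hc : c.Nondegenerate) (hinv : ∀ g s t, c (τ g s) (τ g t) = c s t) :
    ∃ β : LinearMap.BilinForm ℂ (MultSpace τ (doubled ρ)),
      ∀ h h' s t, complexForm V (h.1 s) (h'.1 t) = β h h' * c s t := by
  obtain ⟨s₀, t₀, ht₀⟩ := exists_apply_ne_zero hc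
  -- The factor of proportionality, read off at one pair where `c` does not vanish; uniqueness of
  -- invariant forms makes it valid at every pair.
  let β : LinearMap.BilinForm ℂ (MultSpace τ (doubled ρ)) :=
    (c s₀ t₀)⁻¹ • (complexForm V).compl₁₂ (LinearMap.applyₗ s₀ ∘ₗ Submodule.subtype (multSpace τ (doubled ρ)))
      (LinearMap.applyₗ t₀ ∘ₗ Submodule.subtype (multSpace τ (doubled ρ)))
  refine ⟨β, fun h h' s t => ?_⟩
  obtain ⟨z, hz⟩ := exists_eq_mul_of_invariant hτ hc hinv ((complexForm V).compl₁₂ h.1 h'.1)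
    (fun g s t => by
      simp only [LinearMap.compl₁₂_apply]
      rw [h.2, h'.2, complexForm_invariant])
  have hβ : β h h' = z := by
    change (c s₀ t₀)⁻¹ * ((complexForm V).compl₁₂ h.1 h'.1 s₀ t₀) = z
    rw [hz, mul_comm z, inv_mul_cancel_left₀ ht₀]
  rw [hβ]
  exact hz s t

section Form

variable {ρ} {c : LinearMap.BilinForm ℂ T} (hc : c.Nondegenerate)
  (hinv : ∀ g s t, c (τ g s) (τ g t) = c s t)
  {β : LinearMap.BilinForm ℂ (MultSpace τ (doubled ρ))}
  (hβ : ∀ h h' s t, complexForm V (h.1 s) (h'.1 t) = β h h' * c s t)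

include hc hβ

omit [FiniteDimensional ℂ T] in
-- The product of `β` and `c` is a symmetric form, so the two factors have the same sign.
theorem multForm_symm [Nontrivial T] {ε : ℂ} (hε : ε * ε = 1) (hcε : ∀ s t, c t s = ε * c s t)
    (h h' : MultSpace τ (doubled ρ)) : β h' h = ε * β h h' := by
  obtain ⟨s₀, t₀, ht₀⟩ := exists_apply_ne_zero hc
  refine mul_right_cancel₀ ht₀ ?_
  have h1 : β h' h * c t₀ s₀ = β h h' * c s₀ t₀ := by
    rw [← hβ, ← hβ, complexForm_comm]
  rw [hcε s₀ t₀] at h1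
  calc β h' h * c s₀ t₀ = (ε * ε) * (β h' h * c s₀ t₀) := by rw [hε, one_mul]
    _ = ε * (β h' h * (ε * c s₀ t₀)) := by ring
    _ = ε * β h h' * c s₀ t₀ := by rw [h1, mul_assoc]

omit [FiniteDimensional ℂ T] in
theorem multForm_adjoint [FiniteDimensional ℚ V] [Nontrivial T] (a : EndG (doubled ρ)) (h h' : MultSpace τ (doubled ρ)) :
    β h (multAction τ _ a h') = β (multAction τ _ (tildeSigma ρ a).unop h) h' := by
  obtain ⟨s₀, t₀, ht₀⟩ := exists_apply_ne_zero hc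
  refine mul_right_cancel₀ ht₀ ?_
  rw [← hβ, ← hβ, multAction_apply, multAction_apply]
  exact (complexForm_adjoint _ _ (tildeSigma_adjoint ρ a) _ _).symm

include hinv

/-- If `h ≠ 0`, its adjoint `k` is nonzero and has a section `h'`. Then `c s t = c s (k (h' t)) = β
h h' * c s t`, so `β h h' = 0` would force `c = 0`. -/
theorem multForm_separating [FiniteDimensional ℚ V] [Finite G] [Nontrivial T] (hτ : τ.IsIrreducible)
    (h : MultSpace τ (doubled ρ)) (hh : ∀ h', β h h' = 0) : h = 0 := by
  by_contra h0
  obtain ⟨k, hk⟩ := exists_adjoint ρ hc hinv h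
  have hk0 : k ≠ 0 := by
    rintro rfl
    refine h0 (Subtype.ext (LinearMap.ext fun s => ?_))
    refine complexForm_nondegenerate.1 _ fun x => ?_
    rw [← hk]
    exact map_zero (c s)
  obtain ⟨h', hh'⟩ := exists_section hτ _ k hk0
  obtain ⟨s₀, hs₀⟩ := exists_ne (0 : T)
  refine hs₀ (hc.1 s₀ fun t => ?_)
  rw [← hh' t, hk, hβ, hh, zero_mul]

/-- With `k` the adjoint of `h₂`, the operator `h ↦ β h₂ h • h₁` is composition with `h₁ ∘ k`. This
is equivariant, hence a complex combination of rational equivariant operators, and such combinations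
act on the multiplicity space within the span. Rank one operators then give everything. -/
theorem span_range_multAction_eq_top [FiniteDimensional ℚ V] [Finite G] (hβn : β.Nondegenerate) :
    Submodule.span ℂ (Set.range (multAction τ (doubled ρ))) = ⊤ := by
  classical
  have key : ∀ Θ ∈ Submodule.span ℂ
      (Set.range fun f : EndG (doubled ρ) => f.toLinearMap.baseChange ℂ),
      ∃ F ∈ Submodule.span ℂ (Set.range (multAction τ (doubled ρ))),
        ∀ h t, (F h).1 t = Θ (h.1 t) := by
    intro Θ hΘ
    induction hΘ using Submodule.span_induction with
    | mem Θ h =>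
      obtain ⟨a, rfl⟩ := h
      exact ⟨_, Submodule.subset_span ⟨a, rfl⟩, fun h t => rfl⟩
    | zero => exact ⟨0, Submodule.zero_mem _, fun h t => rfl⟩
    | add Θ Θ' _ _ h h' =>
      obtain ⟨F, hF, hF'⟩ := h
      obtain ⟨F₁, hF₁, hF₁'⟩ := h'
      refine ⟨F + F₁, Submodule.add_mem _ hF hF₁, fun h t => ?_⟩
      rw [LinearMap.add_apply Θ, ← hF', ← hF₁']
      rfl
    | smul z Θ _ h =>
      obtain ⟨F, hF, hF'⟩ := h
      refine ⟨z • F, Submodule.smul_mem _ z hF, fun h t => ?_⟩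
      change z • (F h).1 t = z • Θ (h.1 t)
      rw [hF']
  have rank_one : ∀ h₁ h₂ : MultSpace τ (doubled ρ), (β h₂).smulRight h₁ ∈
      Submodule.span ℂ (Set.range (multAction τ (doubled ρ))) := by
    intro h₁ h₂
    obtain ⟨k, hk⟩ := exists_adjoint ρ hc hinv h₂
    obtain ⟨F, hF, hF'⟩ := key (h₁.1 ∘ₗ k.toLinearMap) (mem_span_of_commute _ _ fun g => by
      refine LinearMap.ext fun x => ?_
      change h₁.1 (k (complexify (doubled ρ) g x)) = complexify (doubled ρ) g (h₁.1 (k x))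
      rw [k.isIntertwining, h₁.2])
    convert hF
    refine LinearMap.ext fun h => Subtype.ext (LinearMap.ext fun t => ?_)
    rw [hF']
    change β h₂ h • h₁.1 t = h₁.1 (k (h.1 t))
    rw [← map_smul]
    congr 1
    refine sub_eq_zero.1 (hc.2 _ fun s => ?_)
    rw [map_sub, hk, hβ, map_smul, smul_eq_mul, sub_self]
  exact eq_top_of_rank_one_mem hβn _ rank_one

end Form

end MultiplicitySpace

/-! ### Invariants of the exterior square and alternating invariant forms -/

section ExteriorSquare

variable {G : Type w} [Group G] {T : Type v} [AddCommGroup T] [Module ℂ T]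

theorem extSquare_ιMulti (τ : Representation ℂ G T) (g : G) (a : Fin 2 → T) :
    extSquare τ g (exteriorPower.ιMulti ℂ 2 a) = exteriorPower.ιMulti ℂ 2 (τ g ∘ a) :=
  exteriorPower.map_apply_ιMulti _ _

theorem update_vecCons_one {α : Type*} (s t x : α) :
    Function.update ![s, t] 1 x = ![s, x] := by
  ext i
  fin_cases i <;> simp [Function.update]

/-- The bilinear form which belongs to a linear functional on the exterior square. -/
def formOfFunctional (ℓ : ⋀[ℂ]^2 T →ₗ[ℂ] ℂ) : LinearMap.BilinForm ℂ T :=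
  LinearMap.mk₂ ℂ (fun s t => ℓ (exteriorPower.ιMulti ℂ 2 ![s, t]))
    (fun s s' t => by
      rw [← map_add]; congr 1
      exact (exteriorPower.ιMulti ℂ 2).map_vecCons_add ![t] s s')
    (fun z s t => by
      rw [← map_smul]; congr 1
      exact (exteriorPower.ιMulti ℂ 2).map_vecCons_smul ![t] z s)
    (fun s t t' => by
      rw [← map_add]; congr 1
      simpa only [update_vecCons_one] using (exteriorPower.ιMulti ℂ 2).map_update_add ![s, t] 1 t t')
    (fun z s t => by
      rw [← map_smul]; congr 1
      simpa only [update_vecCons_one] using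
        (exteriorPower.ιMulti ℂ 2).map_update_smul ![s, t] 1 z t)

/-- The functional on the exterior square which belongs to an alternating form. -/
def functionalOfForm (d : LinearMap.BilinForm ℂ T) (hd : d.IsAlt) : ⋀[ℂ]^2 T →ₗ[ℂ] ℂ :=
  exteriorPower.alternatingMapLinearEquiv
    { toFun v := d (v 0) (v 1)
      map_update_add' v i x y := by
        fin_cases i <;> simp [Function.update]
      map_update_smul' v i z x := by
        fin_cases i <;> simp [Function.update]
      map_eq_zero_of_eq' v i j hij hne := by
        fin_cases i <;> fin_cases j <;> simp_all [hd.self_eq_zero] }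

theorem functionalOfForm_ιMulti (d : LinearMap.BilinForm ℂ T) (hd : d.IsAlt) (a : Fin 2 → T) :
    functionalOfForm d hd (exteriorPower.ιMulti ℂ 2 a) = d (a 0) (a 1) :=
  exteriorPower.alternatingMapLinearEquiv_apply_ιMulti _ _

variable [Finite G] {τ : Representation ℂ G T}

/-- Take a functional that is nonzero on an invariant vector `ω` and sum it over `G`: the result is
invariant, and its value at `ω` is only multiplied by the order of `G`. -/
theorem exists_alternating_of_invariants_ne_bot (h : (extSquare τ).invariants ≠ ⊥) :
    ∃ d : LinearMap.BilinForm ℂ T, d.IsAlt ∧ (∀ g s t, d (τ g s) (τ g t) = d s t) ∧ d ≠ 0 := by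
  have := Fintype.ofFinite G
  obtain ⟨ω, hω, hω0⟩ := Submodule.exists_mem_ne_zero_of_ne_bot h
  obtain ⟨ℓ, hℓ⟩ : ∃ ℓ : Module.Dual ℂ (⋀[ℂ]^2 T), ℓ ω ≠ 0 := by
    by_contra! h
    exact hω0 ((Module.forall_dual_apply_eq_zero_iff ℂ ω).1 h)
  let ℓ' : ⋀[ℂ]^2 T →ₗ[ℂ] ℂ := ∑ g, ℓ ∘ₗ extSquare τ g
  have hℓ' : ∀ w, ℓ' w = ∑ g, ℓ (extSquare τ g w) := fun w => by
    simp only [ℓ', LinearMap.sum_apply, LinearMap.comp_apply]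
  have hinv : ∀ g w, ℓ' (extSquare τ g w) = ℓ' w := fun g w => by
    rw [hℓ', hℓ']
    refine Fintype.sum_equiv (Equiv.mulRight g) _ _ fun h => ?_
    rw [Equiv.coe_mulRight, map_mul, Module.End.mul_apply]
  have hd : ∀ s t, formOfFunctional ℓ' s t = ℓ' (exteriorPower.ιMulti ℂ 2 ![s, t]) :=
    fun _ _ => rfl
  refine ⟨formOfFunctional ℓ', fun s => ?_, fun g s t => ?_, fun h0 => ?_⟩
  · rw [hd, (exteriorPower.ιMulti ℂ 2).map_eq_zero_of_eq ![s, s] (i := 0) (j := 1) rfl (by decide),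
      map_zero]
  · rw [hd, hd, ← hinv g (exteriorPower.ιMulti ℂ 2 ![s, t]), extSquare_ιMulti]
    refine congrArg (fun a => ℓ' (exteriorPower.ιMulti ℂ 2 a)) ?_
    ext i
    fin_cases i <;> rfl
  · have h1 : ℓ' = 0 := by
      refine exteriorPower.linearMap_ext (AlternatingMap.ext fun a => ?_)
      have h2 := LinearMap.congr_fun₂ h0 (a 0) (a 1)
      rw [hd] at h2
      have h3 : ![a 0, a 1] = a := by
        ext i
        fin_cases i <;> rfl
      rw [h3] at h2
      exact h2
    have h2 : ℓ' ω = Fintype.card G * ℓ ω := by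
      rw [hℓ', Finset.sum_congr rfl fun g _ => congrArg ℓ (hω g), Finset.sum_const,
        Finset.card_univ, nsmul_eq_mul]
    rw [h1, LinearMap.zero_apply, zero_eq_mul] at h2
    exact h2.elim (Nat.cast_ne_zero.2 Fintype.card_ne_zero) hℓ

/-- An invariant functional takes the value `|G| ℓ(w)` at the orbit sum of `w`, and that sum is an
invariant vector, hence zero. -/
theorem eq_zero_of_invariants_eq_bot (h : (extSquare τ).invariants = ⊥)
    (d : LinearMap.BilinForm ℂ T) (hd : d.IsAlt) (hinv : ∀ g s t, d (τ g s) (τ g t) = d s t) :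
    d = 0 := by
  have := Fintype.ofFinite G
  let ℓ := functionalOfForm d hd
  have hℓ : ∀ g, ℓ ∘ₗ extSquare τ g = ℓ := fun g => by
    refine exteriorPower.linearMap_ext (AlternatingMap.ext fun a => ?_)
    change ℓ (extSquare τ g (exteriorPower.ιMulti ℂ 2 a)) = ℓ (exteriorPower.ιMulti ℂ 2 a)
    rw [extSquare_ιMulti, functionalOfForm_ιMulti, functionalOfForm_ιMulti]
    exact hinv g _ _
  have hsum : ∀ w, ∑ g, extSquare τ g w = 0 := fun w => by
    rw [← Submodule.mem_bot ℂ, ← h]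
    intro g
    rw [map_sum]
    refine Fintype.sum_equiv (Equiv.mulLeft g) _ _ fun k => ?_
    rw [Equiv.coe_mulLeft, map_mul, Module.End.mul_apply]
  ext s t
  have h1 := congrArg ℓ (hsum (exteriorPower.ιMulti ℂ 2 ![s, t]))
  have h2 : ∀ g w, ℓ (extSquare τ g w) = ℓ w := fun g => LinearMap.congr_fun (hℓ g)
  rw [map_sum, Finset.sum_congr rfl fun g _ => h2 g _, Finset.sum_const,
    Finset.card_univ, nsmul_eq_mul, map_zero, functionalOfForm_ιMulti] at h1
  exact (mul_eq_zero.1 h1).resolve_left (Nat.cast_ne_zero.2 Fintype.card_ne_zero)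

end ExteriorSquare

/-! ### The sign of the invariant form on a self-dual irreducible representation -/

section SelfDual

variable {G : Type w} [Group G] {T : Type v} [AddCommGroup T] [Module ℂ T]
  [FiniteDimensional ℂ T] {τ : Representation ℂ G T}

omit [FiniteDimensional ℂ T] in
theorem exists_invariant_form (h : IsSelfDual τ) :
    ∃ c : LinearMap.BilinForm ℂ T, c.Nondegenerate ∧ ∀ g s t, c (τ g s) (τ g t) = c s t := by
  obtain ⟨ψ⟩ := h
  refine ⟨ψ.toIntertwiningMap.toLinearMap, ⟨fun s hs => ?_, fun t ht => ?_⟩, fun g s t => ?_⟩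
  · exact ψ.toLinearEquiv.map_eq_zero_iff.1 (LinearMap.ext hs)
  · refine (Module.forall_dual_apply_eq_zero_iff ℂ t).1 fun η => ?_
    obtain ⟨s, rfl⟩ := ψ.toLinearEquiv.surjective η
    exact ht s
  · have h1 := LinearMap.congr_fun (LinearMap.congr_fun (ψ.toIntertwiningMap.isIntertwining' g) s) (τ g t)
    refine h1.trans ?_
    rw [Representation.dual_apply, LinearMap.comp_apply,
      Module.Dual.transpose_apply, LinearMap.comp_apply, Representation.inv_self_apply]

omit [FiniteDimensional ℂ T] in
-- The difference of `c` and its flip is alternating and invariant, so it vanishes.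
theorem form_symm_of_invariants_eq_bot [Finite G] {c : LinearMap.BilinForm ℂ T}
    (hinv : ∀ g s t, c (τ g s) (τ g t) = c s t) (h : (extSquare τ).invariants = ⊥) (s t : T) :
    c t s = c s t := by
  have h0 := eq_zero_of_invariants_eq_bot h (c - c.flip)
    (fun s => by rw [LinearMap.sub_apply, LinearMap.sub_apply, LinearMap.BilinForm.flip_apply, sub_self])
    (fun g s t => by
      simp only [LinearMap.sub_apply, LinearMap.BilinForm.flip_apply, hinv])
  have h1 := LinearMap.congr_fun₂ h0 t s
  rw [LinearMap.sub_apply, LinearMap.sub_apply, LinearMap.BilinForm.flip_apply] at h1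
  exact sub_eq_zero.1 h1

/-- A nonzero invariant vector yields a nonzero alternating invariant form. It is a nonzero multiple
of `c` by uniqueness. -/
theorem form_skew_of_invariants_ne_bot [Finite G] (hτ : τ.IsIrreducible)
    {c : LinearMap.BilinForm ℂ T} (hc : c.Nondegenerate)
    (hinv : ∀ g s t, c (τ g s) (τ g t) = c s t) (h : (extSquare τ).invariants ≠ ⊥) (s t : T) :
    c t s = - c s t := by
  obtain ⟨d, hd, hdinv, hd0⟩ := exists_alternating_of_invariants_ne_bot h
  obtain ⟨z, hz⟩ := exists_eq_mul_of_invariant hτ hc hinv d hdinv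
  have hz0 : z ≠ 0 := by
    rintro rfl
    exact hd0 (LinearMap.ext₂ fun s t => (hz s t).trans (zero_mul _))
  have h1 := hd.neg_eq s t
  rw [hz, hz, ← mul_neg] at h1
  exact (mul_left_cancel₀ hz0 h1).symm

end SelfDual

/-! ### From a spanning action with an adjoint form to a splitting -/

section Main

theorem exists_eq_algebraMap {A : Type*} [Ring A] {L : Type*} [Field L] {H : Type*}
    [AddCommGroup H] [Module L H] (φ : A →+* Module.End L H)
    (hspan : Submodule.span L (Set.range φ) = ⊤) {z : A} (hz : z ∈ Subring.center A) :
    ∃ k : L, φ z = algebraMap L _ k := by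
  refine (Algebra.IsCentral.mem_center_iff L).1 (Subalgebra.mem_center_iff.2 fun f => ?_)
  have hf : f ∈ Submodule.span L (Set.range φ) := by rw [hspan]; trivial
  induction hf using Submodule.span_induction with
  | mem f hf =>
    obtain ⟨a, rfl⟩ := hf
    rw [← map_mul, ← map_mul, Subring.mem_center_iff.1 hz]
  | zero => rw [zero_mul, mul_zero]
  | add f f' _ _ h h' => rw [add_mul, mul_add, h, h']
  | smul c f _ h => rw [smul_mul_assoc, mul_smul_comm, h]

variable {A : Type u} [Ring A] {σ : RingInvo A}

/-- A central element acts by a scalar, and scalars are self-adjoint. So `z` and its image under `σ`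
act alike, and the action of a simple ring on a nonzero space is faithful. -/
theorem isFirstKind_of_form [IsSimpleRing A] {L : Type*} [Field L] {H : Type*} [AddCommGroup H]
    [Module L H] [Nontrivial H] (φ : A →+* Module.End L H)
    (hspan : Submodule.span L (Set.range φ) = ⊤) (β : LinearMap.BilinForm L H)
    (hβ : β.Nondegenerate) (hadj : ∀ a x y, β x (φ a y) = β (φ (σ a).unop x) y) :
    IsFirstKind σ := by
  intro z hz
  obtain ⟨k, hk⟩ := exists_eq_algebraMap φ hspan hz
  refine φ.injective (LinearMap.ext fun x => sub_eq_zero.1 (hβ.1 _ fun y => ?_))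
  rw [map_sub, LinearMap.sub_apply, ← hadj, hk, Module.algebraMap_end_apply,
    Module.algebraMap_end_apply, map_smul, map_smul, LinearMap.smul_apply, sub_self]

/-- Linear endomorphisms over a field and over its lift to another universe agree. -/
def endULift (L : Type) [Field L] (H : Type*) [AddCommGroup H] [Module L H] :
    Module.End L H ≃+* Module.End (ULift.{u} L) H where
  toFun f := { f with map_smul' := fun c x => f.map_smul c.down x }
  invFun f := { f with map_smul' := fun c x => f.map_smul (ULift.up c) x }
  left_inv _ := rfl
  right_inv _ := rfl
  map_mul' _ _ := rfl
  map_add' _ _ := rfl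

/-- The splitting over a copy of `L` which is given by an action on a vector space over `L`. -/
theorem exists_splitting [IsSimpleRing A] {L : Type} [Field L] {H : Type u} [AddCommGroup H]
    [Module L H] [Nontrivial H] (φ : A →+* Module.End L H)
    (hspan : Submodule.span L (Set.range φ) = ⊤) (β : LinearMap.BilinForm L H)
    (hβ : β.Nondegenerate) (hadj : ∀ a x y, β x (φ a y) = β (φ (σ a).unop x) y) :
    ∃ (_ : Algebra (Subring.center A) (ULift.{u} L)) (s : Splitting σ (ULift.{u} L) H),
      ∀ x y, s.form x y = ULift.up (β x y) := by
  choose k hk using fun z : Subring.center A => exists_eq_algebraMap φ hspan z.2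
  have hinj := (algebraMap L (Module.End L H)).injective
  -- The centre acts on `H` through scalars, and this character makes `L` an extension of the
  -- centre.
  let χ : Subring.center A →+* L :=
    { toFun := k
      map_one' := hinj (by rw [← hk, map_one]; exact map_one φ)
      map_mul' := fun z z' => hinj (by rw [map_mul, ← hk, ← hk, ← hk]; exact map_mul φ _ _)
      map_zero' := hinj (by rw [← hk, map_zero]; exact map_zero φ)
      map_add' := fun z z' => hinj (by rw [map_add, ← hk, ← hk, ← hk]; exact map_add φ _ _) }
  let : Algebra (Subring.center A) (ULift.{u} L) :=
    (ULift.ringEquiv.symm.toRingHom.comp χ).toAlgebra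
  let ι := endULift.{u} L H
  have hspan' : Submodule.span (ULift.{u} L) (Set.range (ι.toRingHom.comp φ)) = ⊤ := by
    rw [Submodule.eq_top_iff']
    intro f
    obtain ⟨f, rfl⟩ := ι.surjective f
    have hf : f ∈ Submodule.span L (Set.range φ) := by rw [hspan]; trivial
    induction hf using Submodule.span_induction with
    | mem f hf =>
      obtain ⟨a, rfl⟩ := hf
      exact Submodule.subset_span ⟨a, rfl⟩
    | zero => rw [map_zero]; exact Submodule.zero_mem _
    | add f f' _ _ h h' => rw [map_add]; exact Submodule.add_mem _ h h'
    | smul c f _ h => exact Submodule.smul_mem _ (ULift.up c) h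
  obtain ⟨e, he⟩ := exists_algEquiv_of_span_range_eq_top (L := ULift.{u} L) (ι.toRingHom.comp φ)
    (fun z => congrArg ι (hk z)) hspan'
  let β' : LinearMap.BilinForm (ULift.{u} L) H :=
    LinearMap.mk₂ _ (fun x y => ULift.up (β x y))
      (fun x x' y => by rw [map_add]; rfl)
      (fun c x y => by rw [ULift.smul_def, map_smul]; rfl)
      (fun x y y' => by rw [map_add]; rfl)
      (fun c x y => by rw [ULift.smul_def, map_smul]; rfl)
  have hβ' : ∀ x y, β' x y = ULift.up (β x y) := fun _ _ => rfl
  refine ⟨inferInstance, ⟨e, β', ⟨fun x hx => hβ.1 x fun y => ?_, fun y hy => hβ.2 y fun x => ?_⟩,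
    fun a x y => ?_⟩, hβ'⟩
  · exact congrArg ULift.down (hx y)
  · exact congrArg ULift.down (hy x)
  · rw [he, he]
    exact congrArg ULift.up (hadj a x y)

end Main

/-! ### Reading off the type of the involution -/

section Assembly

theorem finiteDimensional_uLift (L : Type) [Field L] (W : Type*) [AddCommGroup W] [Module L W]
    [FiniteDimensional L W] : FiniteDimensional (ULift.{u} L) W := by
  obtain ⟨s, hs⟩ := Module.Finite.fg_top (R := L) (M := W)
  refine ⟨⟨s, Submodule.eq_top_iff'.2 fun x => ?_⟩⟩
  have hx : x ∈ Submodule.span L (s : Set W) := by rw [hs]; trivial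
  induction hx using Submodule.span_induction with
  | mem x hx => exact Submodule.subset_span hx
  | zero => exact Submodule.zero_mem _
  | add x y _ _ hx hy => exact Submodule.add_mem _ hx hy
  | smul c x _ hx => exact Submodule.smul_mem _ (ULift.up c) hx

/-- The type of an involution can be read off from the sign of an invariant form on an irreducible
complex module. -/
theorem type_of_form {A : Type u} [Ring A] [IsSimpleRing A]
    [Module.Finite (Subring.center A) A] [CharZero (Subring.center A)] {σ : RingInvo A}
    {H : Type*} [AddCommGroup H] [Module ℂ H] [FiniteDimensional ℂ H] [Nontrivial H]
    (φ : A →+* Module.End ℂ H) (hspan : Submodule.span ℂ (Set.range φ) = ⊤)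
    (β : LinearMap.BilinForm ℂ H) (hβ : β.Nondegenerate)
    (hadj : ∀ a x y, β x (φ a y) = β (φ (σ a).unop x) y) :
    ((∀ x y, β y x = - β x y) → IsSymplectic σ) ∧ ((∀ x y, β y x = β x y) → IsOrthogonal σ) := by
  have hσ := isFirstKind_of_form φ hspan β hβ hadj
  -- A splitting lives in the universe of `A`, so `H` is replaced by a coordinate space there.
  let W := ULift.{u} (Fin (Module.finrank ℂ H) → ℂ)
  let e : H ≃ₗ[ℂ] W := (Module.finBasis ℂ H).equivFun.trans ULift.moduleEquiv.symm
  let κ : Module.End ℂ H ≃ₐ[ℂ] Module.End ℂ W := e.conjAlgEquiv ℂ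
  have hκ : ∀ f x, κ f x = e (f (e.symm x)) := fun _ _ => rfl
  have : Nontrivial W := e.symm.toEquiv.nontrivial
  have : FiniteDimensional ℂ W := e.finiteDimensional
  have : FiniteDimensional (ULift.{u} ℂ) W := finiteDimensional_uLift ℂ W
  let β' : LinearMap.BilinForm ℂ W := β.compl₁₂ e.symm.toLinearMap e.symm.toLinearMap
  have hβ' : ∀ x y, β' x y = β (e.symm x) (e.symm y) := fun _ _ => rfl
  obtain ⟨_, s, hs⟩ := exists_splitting (σ := σ) (κ.toRingEquiv.toRingHom.comp φ)
    (by
      have h : Set.range (κ.toRingEquiv.toRingHom.comp φ) = κ.toLinearMap '' Set.range φ := by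
        rw [← Set.range_comp]; rfl
      rw [h, Submodule.span_image, hspan, Submodule.map_top, LinearMap.range_eq_top]
      exact κ.surjective)
    β'
    ⟨fun x hx => e.symm.map_eq_zero_iff.1 (hβ.1 _ fun y => by
        have := hx (e y)
        rwa [hβ', e.symm_apply_apply] at this),
      fun y hy => e.symm.map_eq_zero_iff.1 (hβ.2 _ fun x => by
        have := hy (e x)
        rwa [hβ', e.symm_apply_apply] at this)⟩
    (fun a x y => by
      change β (e.symm x) (e.symm (e (φ a (e.symm y)))) =
        β (e.symm (e (φ (σ a).unop (e.symm x)))) (e.symm y)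
      rw [e.symm_apply_apply, e.symm_apply_apply, hadj])
  refine ⟨fun h => isSymplectic_of_splitting s hσ fun x y => ?_,
    fun h => isOrthogonal_of_splitting s hσ fun x y => ?_⟩
  · rw [hs, hs, hβ', h, hβ']
    rfl
  · rw [hs, hs, hβ', h, hβ']

variable {G : Type w} [Group G] [Finite G]

section Algebra

variable {M : Type u} [AddCommGroup M] [Module ℚ M] (π : Representation ℚ G M)

/-- The rational numbers, as scalars in the centre of `End_G(π)`. -/
def ratToCenter : ℚ →+* Subring.center (EndG π) :=
  (algebraMap ℚ (EndG π)).codRestrict (Subring.center (EndG π)) fun q =>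
    Subring.mem_center_iff.2 fun a => (Algebra.commutes q a).symm

omit [Finite G] in
theorem charZero_center [Nontrivial (EndG π)] : CharZero (Subring.center (EndG π)) :=
  charZero_of_injective_ringHom (ratToCenter π).injective

omit [Finite G] in
theorem finite_over_center [FiniteDimensional ℚ M] :
    Module.Finite (Subring.center (EndG π)) (EndG π) := by
  let : Algebra ℚ (Subring.center (EndG π)) := (ratToCenter π).toAlgebra
  have : IsScalarTower ℚ (Subring.center (EndG π)) (EndG π) :=
    IsScalarTower.of_algebraMap_eq fun _ => rfl
  exact Module.Finite.of_restrictScalars_finite ℚ _ _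

end Algebra

variable {U : Type u} [AddCommGroup U] [Module ℚ U] [FiniteDimensional ℚ U]
  {T : Type v} [AddCommGroup T] [Module ℂ T]

omit [Finite G] in
theorem nontrivial_of_isIrreducible {τ : Representation ℂ G T} (hτ : τ.IsIrreducible) :
    Nontrivial T :=
  have := (Representation.irreducible_iff_isSimpleModule_asModule τ).1 hτ
  IsSimpleModule.nontrivial (MonoidAlgebra ℂ G) τ.asModule

omit [Finite G] [FiniteDimensional ℚ U] in
-- Compose the embedding of `τ` with the diagonal `ρ → ρⁿ ⊕ (ρⁿ)*`. The projection to one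
-- coordinate, available as `n ≥ 1`, shows that the composite is nonzero.
theorem nontrivial_multSpace (ρ : Representation ℚ G U) (n : ℕ) (hn : 1 ≤ n)
    (τ : Representation ℂ G T) (hτ : IsIrreducibleConstituent τ (complexify ρ)) :
    Nontrivial (MultSpace τ (doubled (power ρ n))) := by
  obtain ⟨hirr, f, hf⟩ := hτ
  have := nontrivial_of_isIrreducible hirr
  let i : U →ₗ[ℚ] (Fin n → U) × Module.Dual ℚ (Fin n → U) :=
    LinearMap.inl ℚ _ _ ∘ₗ LinearMap.pi fun _ => LinearMap.id
  let p : (Fin n → U) × Module.Dual ℚ (Fin n → U) →ₗ[ℚ] U :=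
    LinearMap.proj ⟨0, hn⟩ ∘ₗ LinearMap.fst ℚ _ _
  have hi : ∀ g x, i (ρ g x) = doubled (power ρ n) g (i x) := fun g x =>
    Prod.ext rfl (map_zero ((power ρ n).dual g)).symm
  have hi' : ∀ g x, i.baseChange ℂ (complexify ρ g x) =
      complexify (doubled (power ρ n)) g (i.baseChange ℂ x) := fun g x => by
    induction x with
    | zero => simp only [map_zero]
    | add x y hx hy => simp only [map_add, hx, hy]
    | tmul z x => exact congrArg (z ⊗ₜ[ℚ] ·) (hi g x)
  have hpi : ∀ x, p.baseChange ℂ (i.baseChange ℂ x) = x := fun x => by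
    induction x with
    | zero => simp only [map_zero]
    | add x y hx hy => simp only [map_add, hx, hy]
    | tmul z x => rfl
  let h : MultSpace τ (doubled (power ρ n)) := ⟨i.baseChange ℂ ∘ₗ f.toLinearMap, fun g t => by
    refine (congrArg (i.baseChange ℂ) (LinearMap.congr_fun (f.isIntertwining' g) t)).trans (hi' g _)⟩
  refine nontrivial_of_ne h 0 fun h0 => ?_
  obtain ⟨t, ht⟩ := exists_ne (0 : T)
  refine ht (hf ?_)
  have h1 : i.baseChange ℂ (f t) = 0 := LinearMap.congr_fun (congrArg Subtype.val h0) t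
  rw [← hpi (f t), h1, map_zero]
  exact (map_zero f.toLinearMap).symm

theorem type_of_invariant_form (ρ : Representation ℚ G U) (n : ℕ) (hn : 1 ≤ n)
    [IsSimpleRing (EndG (doubled (power ρ n)))] [FiniteDimensional ℂ T]
    (τ : Representation ℂ G T) (hτ : IsIrreducibleConstituent τ (complexify ρ))
    {c : LinearMap.BilinForm ℂ T} (hc : c.Nondegenerate)
    (hinv : ∀ g s t, c (τ g s) (τ g t) = c s t) :
    ((∀ s t, c t s = - c s t) → IsSymplectic (tildeSigma (power ρ n))) ∧
      ((∀ s t, c t s = c s t) → IsOrthogonal (tildeSigma (power ρ n))) := by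
  have := finite_over_center (doubled (power ρ n))
  have := charZero_center (doubled (power ρ n))
  have := nontrivial_of_isIrreducible hτ.1
  have := nontrivial_multSpace ρ n hn τ hτ
  obtain ⟨β, hβ⟩ := exists_multForm (power ρ n) hτ.1 hc hinv
  have hsep := multForm_separating hc hinv hβ hτ.1
  have hadj := multForm_adjoint hc hβ
  refine ⟨fun h => ?_, fun h => ?_⟩
  · have hsymm : ∀ x y, β y x = - β x y := fun x y => by
      rw [multForm_symm hc hβ (ε := -1) (by ring) (fun s t => by rw [h, neg_one_mul]) x y,
        neg_one_mul]
    -- `hsep` covers the left argument only; the sign of `β` transfers it to the right one.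
    have hβn : β.Nondegenerate :=
      ⟨hsep, fun y hy => hsep y fun x => by rw [hsymm, hy, neg_zero]⟩
    exact (type_of_form _ (span_range_multAction_eq_top hc hinv hβ hβn) β hβn hadj).1 hsymm
  · have hsymm : ∀ x y, β y x = β x y := fun x y => by
      rw [multForm_symm hc hβ (ε := 1) (by ring) (fun s t => by rw [h, one_mul]) x y, one_mul]
    have hβn : β.Nondegenerate := ⟨hsep, fun y hy => hsep y fun x => by rw [hsymm, hy]⟩
    exact (type_of_form _ (span_range_multAction_eq_top hc hinv hβ hβn) β hβn hadj).2 hsymm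

end Assembly

end

end RepInvolution

theorem mainTheorem10 {G : Type*} [Group G] [Finite G]
    {U : Type*} [AddCommGroup U] [Module ℚ U] [FiniteDimensional ℚ U]
    (ρ : Representation ℚ G U) (hρ : ρ.IsIrreducible)
    (n : ℕ) (hn : 1 ≤ n)
    {T : Type*} [AddCommGroup T] [Module ℂ T] [FiniteDimensional ℂ T]
    (τ : Representation ℂ G T)
    (hτ : RepInvolution.IsIrreducibleConstituent τ (RepInvolution.complexify ρ)) :
    IsSimpleRing (RepInvolution.EndG (RepInvolution.doubled (RepInvolution.power ρ n))) ∧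
    (¬ RepInvolution.IsSelfDual τ →
      RepInvolution.IsSecondKind (RepInvolution.tildeSigma (RepInvolution.power ρ n))) ∧
    (RepInvolution.IsSelfDual τ → (RepInvolution.extSquare τ).invariants ≠ ⊥ →
      RepInvolution.IsSymplectic (RepInvolution.tildeSigma (RepInvolution.power ρ n))) ∧
    (RepInvolution.IsSelfDual τ → (RepInvolution.extSquare τ).invariants = ⊥ →
      RepInvolution.IsOrthogonal (RepInvolution.tildeSigma (RepInvolution.power ρ n))) := by
  have hsimple := RepInvolution.isSimpleRing_endG ρ hρ n hn
  refine ⟨hsimple, RepInvolution.isSecondKind_of_not_isSelfDual ρ n hn τ hτ,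
    fun hdual h => ?_, fun hdual h => ?_⟩
  · obtain ⟨c, hc, hinv⟩ := RepInvolution.exists_invariant_form hdual
    exact (RepInvolution.type_of_invariant_form ρ n hn τ hτ hc hinv).1
      (RepInvolution.form_skew_of_invariants_ne_bot hτ.1 hc hinv h)
  · obtain ⟨c, hc, hinv⟩ := RepInvolution.exists_invariant_form hdual
    exact (RepInvolution.type_of_invariant_form ρ n hn τ hτ hc hinv).2
      (RepInvolution.form_symm_of_invariants_eq_bot hinv h)
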